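/- Let $d\ge 1$ agents form a connected undirected graph on $\{1,\dots,d\}$ with edge set $E$, let $f_i:\mathbb R^{n\times p}\to\mathbb R$ ($i=1,\dots,d$), and consider $$\min_{X\in\mathbb R^{n\times p}} f(X):=\frac1d\sum_{i=1}^d f_i(X)\quad\text{s.t. } X^\top X=I_p .$$ Write $\mathcal S_{n,p}=\{X: X^\top X=I_p\}$, $\mathrm{sym}(B)=(B+B^\top)/2$, $\nabla$ for the Euclidean gradient, $\|\cdot\|_F$ for the Frobenius norm and $\|\cdot\|_2$ for the spectral norm. A point $X\in\mathcal S_{n,p}$ is called first-order stationary if $\nabla f(X)-X\,\mathrm{sym}(X^\top\nabla f(X))=0$. **Functions and directions.** For $\beta>0$ let $b(X)=\frac14\|X^\top X-I_p\|_F^2$ and $h(X)=\frac32 f(X)-\frac12 f(XX^\top X)+\beta\, b(X)$, $$G_i(X)=\tfrac32\nabla f_i(XX^\top X)-\tfrac12\nabla f_i(XX^\top X)X^\top X-X\,\mathrm{sym}\big(X^\top\nabla f_i(XX^\top X)\big),$$ $H_i(X)=G_i(X)+\beta X(X^\top X-I_p)$, and let $G$ be given by the same formula as $G_i$ with $f$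 in place of $f_i$ (so $G=\frac1d\sum_i G_i$). **Algorithm DESTINY** with mixing matrix $W\in\mathbb R^{d\times d}$, stepsize $\eta>0$ and initial point $X_{\rm initial}$: $X_{i,0}=X_{\rm initial}$, $D_{i,0}=H_i(X_{\rm initial})$, and $$X_{i,k+1}=\sum_{j=1}^d W(i,j)(X_{j,k}-\eta D_{j,k}),\qquad D_{i,k+1}=\sum_{j=1}^d W(i,j)D_{j,k}+H_i(X_{i,k+1})-H_i(X_{i,k}).$$ Let $\mathbf X_k,\mathbf D_k\in\mathbb R^{dn\times p}$ be the matrices with blocks $X_{1,k},\dots,X_{d,k}$ and $D_{1,k},\dots,D_{d,k}$ stacked on top of each other, let $\bar X_k=\frac1d\sum_i X_{i,k}$, $\bar D_k=\frac1d\sum_i D_{i,k}$, and $\bar{\mathbf X}_k=(\mathbf 1_d\otimes I_n)\bar X_k$, $\bar{\mathbf D}_k=(\mathbf 1_d\otimes I_n)\bar D_k$. **Constants.** Let $\mathcal R=\{X:\|X^\top X-I_p\|_F\le 1/6\}$, $\mathcal B=\{X:\|X\|_F\le\sqrt{7dp/6}+\sqrt d\}$, $\lambda=\|W-\mathbf 1_d\mathbf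 1_d^\top/d\|_2$, and $$C_0=\sup_{X\in\mathcal R}\|\nabla f(XX^\top X)\|_F,\quad M_g=\sup_{X\in\mathcal B,\,i}\|G_i(X)\|_F,\quad M_b=\sup_{X\in\mathcal B}\|\nabla b(X)\|_F,$$ $$L_g=\sup_{X\ne Y\in\mathcal B,\,i}\frac{\|G_i(X)-G_i(Y)\|_F}{\|X-Y\|_F},\qquad L_b=\sup_{X\ne Y\in\mathcal B}\frac{\|\nabla b(X)-\nabla b(Y)\|_F}{\|X-Y\|_F},$$ $$L_f=\sup_{X\in\mathcal B,\,X\ne XX^\top X}\frac{\|\nabla f(X)-\nabla f(XX^\top X)\|_F}{\|X(X^\top X-I_p)\|_F},\qquad L=L_g+\beta L_b,\qquad C_1=\frac{\lambda^2(1+\lambda^2)}{1-\lambda^2},$$ $$C_2=\frac{12(1+\lambda^2)L^2}{1-\lambda^2},\quad \rho=\frac{3(1-\lambda^2)}{16C_2},\quad C_D=\|\bar{\mathbf D}_0-\mathbf D_0\|_F+\frac{3\sqrt d}{1-\lambda}+\sqrt d\,(M_g+\beta M_b).$$ **Assumptions.** 1. Each $f_i$ is differentiable and $\nabla f_i$ is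 locally Lipschitz continuous. 2. $W$ is symmetric, entrywise nonnegative, $W\mathbf 1_d=W^\top\mathbf 1_d=\mathbf 1_d$, and $W(i,j)=0$ whenever $i\neq j$ and $(i,j)\notin E$. 3. $\beta>\max\left\{\frac{6+21C_0}{5},\ \frac{72(4+3M_g)}{5},\ \frac1{L_b},\ 22L_f^2\right\}$ and $0<\eta<\min\{\bar\eta_1,\dots,\bar\eta_{12}\}$, where $$\bar\eta_1=\frac{216}{49\beta^2},\quad \bar\eta_2=\frac{12}{7\beta},\quad \bar\eta_3=\frac1{18(4+3M_g)},\quad \bar\eta_4=\frac{5\beta/72-4-3M_g}{(1+M_g)^2},$$ $$\bar\eta_5=\frac{\sqrt d(1-\lambda)}{L\lambda C_D},\quad \bar\eta_6=\frac{\sqrt d}{LC_D},\quad \bar\eta_7=\frac1{8L},\quad \bar\eta_8=\frac1{4\rho dC_2},$$ $$\bar\eta_9=\frac{1-\lambda^2}{2\lambda^2L}\sqrt{\frac1{6(1+\lambda^2)}},\quad \bar\eta_{10}=\sqrt{\frac{d(1-\lambda^2)}{24L^3}},\quad \bar\eta_{11}=\frac{d(1-\lambda^2)}{12L^2},\quad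 \bar\eta_{12}=\sqrt{\frac{3\rho(1-\lambda^2)}{16C_1}}.$$ When $\lambda=0$, the bounds $\bar\eta_5,\bar\eta_9,\bar\eta_{12}$ are read as $+\infty$. (The bound $\bar\eta_{11}$ forces $\lambda<1$.) **Theorem.** Suppose Assumptions 1–3 hold and DESTINY is started from $X_{\rm initial}\in\mathcal R$. Then: (i) The sequence $\{(\mathbf X_k,\mathbf D_k)\}$ has at least one accumulation point. (ii) For every accumulation point $(\mathbf X^*,\mathbf D^*)$ we have $\mathbf X^*=(\mathbf 1_d\otimes I_n)\bar X^*$ for some $\bar X^*\in\mathcal S_{n,p}$ that is a first-order stationary point of the problem. (iii) Put $\tilde h_k:=h(\bar X_k)+\|\bar{\mathbf X}_k-\mathbf X_k\|_F^2+\rho\|\bar{\mathbf D}_k-\mathbf D_k\|_F^2$. The sequence $\{\tilde h_k\}$ is bounded below, and for every lower bound $\underline h$ of it and every integer $K\ge1$, $$\min_{0\le k<K}\|\bar{\mathbf X}_k-\mathbf X_k\|_F^2\le\frac{16(\tilde h_0-\underline h)}{3(1-\lambda^2)K},\qquad \min_{0\le k<K}\|G(\bar X_k)\|_F^2\le\frac{2(\tilde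 h_0-\underline h)}{\eta K},$$ $$\min_{0\le k<K}\|\bar X_k^\top\bar X_k-I_p\|_F^2\le\frac{2(\tilde h_0-\underline h)}{\eta L_f^2K}\quad\text{if }L_f\neq0.$$ (iv) Also when $L_f=0$, there is a constant $C$ such that $\min_{0\le k<K}\|\bar X_k^\top\bar X_k-I_p\|_F^2\le C/K$ for all $K\ge1$. -/

import Mathlib

open Filter Topology
open scoped Matrix

-- All norms of matrices below are Frobenius norms, except for the spectral norm in `mixingRate`.
attribute [local instance] Matrix.frobeniusNormedAddCommGroup Matrix.frobeniusNormedSpace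

namespace Destiny

noncomputable section

/-- The space of real `n × p` matrices. -/
abbrev Mat (n p : ℕ) : Type := Matrix (Fin n) (Fin p) ℝ

/-! ### The optimization problem -/

/-- The Euclidean gradient `∇φ(X)` of a function of a matrix: the matrix of partial derivatives. -/
def matGrad {n p : ℕ} (φ : Mat n p → ℝ) (X : Mat n p) : Mat n p :=
  Matrix.of fun i j => fderiv ℝ φ X (Matrix.single i j 1)

/-- The symmetric part `(A + Aᵀ) / 2`. -/
def symPart {p : ℕ} (A : Mat p p) : Mat p p := (1 / 2 : ℝ) • (A + Aᵀ)

/-- The Stiefel manifold `{X | Xᵀ X = I}`. -/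
def stiefel (n p : ℕ) : Set (Mat n p) := {X | Xᵀ * X = 1}

/-- The global objective `f = (1/d) ∑ i, f i`. -/
def objective {d n p : ℕ} (f : Fin d → Mat n p → ℝ) (X : Mat n p) : ℝ :=
  (1 / (d : ℝ)) * ∑ i, f i X

/-- `X` is a first-order stationary point of the minimization of `φ` over the Stiefel manifold. -/
def IsStationary {n p : ℕ} (φ : Mat n p → ℝ) (X : Mat n p) : Prop :=
  X ∈ stiefel n p ∧ matGrad φ X - X * symPart (Xᵀ * matGrad φ X) = 0

/-- Every local function is differentiable with a locally Lipschitz gradient. -/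
structure SmoothAssumption {d n p : ℕ} (f : Fin d → Mat n p → ℝ) : Prop where
  differentiable : ∀ i, Differentiable ℝ (f i)
  locallyLipschitz_grad : ∀ i, LocallyLipschitz (matGrad (f i))

/-- `W` is a mixing matrix that conforms to the graph `𝒢`. -/
structure MixingAssumption {d : ℕ} (𝒢 : SimpleGraph (Fin d)) (W : Mat d d) : Prop where
  symm : W.IsSymm
  nonneg : ∀ i j, 0 ≤ W i j
  row_sum : W *ᵥ 1 = 1
  col_sum : Wᵀ *ᵥ 1 = 1
  zero_of_not_adj : ∀ i j, i ≠ j → ¬ 𝒢.Adj i j → W i j = 0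

/-! ### The penalty function and the search directions -/

/-- The map `X ↦ X Xᵀ X`. -/
def cubic {n p : ℕ} (X : Mat n p) : Mat n p := X * Xᵀ * X

/-- `b(X) = ‖Xᵀ X - I‖² / 4`. -/
def penaltyB {n p : ℕ} (X : Mat n p) : ℝ := (1 / 4) * ‖Xᵀ * X - 1‖ ^ 2

/-- `h(X) = (3/2) φ(X) - (1/2) φ(X Xᵀ X) + β b(X)`. -/
def penaltyH {n p : ℕ} (φ : Mat n p → ℝ) (β : ℝ) (X : Mat n p) : ℝ :=
  (3 / 2) * φ X - (1 / 2) * φ (cubic X) + β * penaltyB X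

/-- The direction
`(3/2) ∇φ(X Xᵀ X) - (1/2) ∇φ(X Xᵀ X) Xᵀ X - X sym(Xᵀ ∇φ(X Xᵀ X))`.
It is `G` for `φ = objective f` and `G_i` for `φ = f i`. -/
def dirG {n p : ℕ} (φ : Mat n p → ℝ) (X : Mat n p) : Mat n p :=
  (3 / 2 : ℝ) • matGrad φ (cubic X) - (1 / 2 : ℝ) • (matGrad φ (cubic X) * (Xᵀ * X))
    - X * symPart (Xᵀ * matGrad φ (cubic X))

/-- The direction `H_i(X) = G_i(X) + β X (Xᵀ X - I)` (for `φ = f i`). -/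
def dirH {n p : ℕ} (φ : Mat n p → ℝ) (β : ℝ) (X : Mat n p) : Mat n p :=
  dirG φ X + β • (X * (Xᵀ * X - 1))

/-! ### The algorithm. A stacked `dn × p` matrix is the family of its `d` blocks of size `n × p`. -/

/-- The family of local variables `(X_i, D_i)`, `i = 1, …, d`, after `k` iterations of DESTINY
with mixing matrix `W`, penalty parameter `β` and stepsize `η`, started from `Xinit`. -/
def iter {d n p : ℕ} (f : Fin d → Mat n p → ℝ) (W : Mat d d) (β η : ℝ) (Xinit : Mat n p) :
    ℕ → (Fin d → Mat n p) × (Fin d → Mat n p)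
  | 0 => (fun _ => Xinit, fun i => dirH (f i) β Xinit)
  | k + 1 =>
    let X := (iter f W β η Xinit k).1
    let D := (iter f W β η Xinit k).2
    let X' : Fin d → Mat n p := fun i => ∑ j, W i j • (X j - η • D j)
    (X', fun i => ∑ j, W i j • D j + dirH (f i) β (X' i) - dirH (f i) β (X i))

/-- The average of the blocks of a stacked matrix. -/
def avg {d n p : ℕ} (Z : Fin d → Mat n p) : Mat n p := (1 / (d : ℝ)) • ∑ i, Z i

/-- The Frobenius norm of a stacked `dn × p` matrix. -/
def stackNorm {d n p : ℕ} (Z : Fin d → Mat n p) : ℝ := Real.sqrt (∑ i, ‖Z i‖ ^ 2)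

/-- The distance `‖Z̄ - Z‖` of a stacked matrix to the matrix all of whose blocks are the average
of its blocks. -/
def consensusError {d n p : ℕ} (Z : Fin d → Mat n p) : ℝ := stackNorm fun i => avg Z - Z i

/-! ### Constants -/

/-- The region `{X | ‖Xᵀ X - I‖ ≤ 1/6}`. -/
def regionR (n p : ℕ) : Set (Mat n p) := {X | ‖Xᵀ * X - 1‖ ≤ 1 / 6}

/-- The ball `{X | ‖X‖ ≤ √(7dp/6) + √d}`. -/
def ballB (d n p : ℕ) : Set (Mat n p) :=
  {X | ‖X‖ ≤ Real.sqrt (7 * d * p / 6) + Real.sqrt d}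

/-- `λ`, the spectral norm of `W - 1 1ᵀ / d`. -/
def mixingRate {d : ℕ} (W : Mat d d) : ℝ :=
  ‖Matrix.toEuclideanCLM (n := Fin d) (𝕜 := ℝ) (W - Matrix.of fun _ _ => 1 / (d : ℝ))‖

def C0 {d n p : ℕ} (f : Fin d → Mat n p → ℝ) : ℝ :=
  sSup {r | ∃ X ∈ regionR n p, r = ‖matGrad (objective f) (cubic X)‖}

def Mg {d n p : ℕ} (f : Fin d → Mat n p → ℝ) : ℝ :=
  sSup {r | ∃ X ∈ ballB d n p, ∃ i, r = ‖dirG (f i) X‖}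

def Mb (d n p : ℕ) : ℝ :=
  sSup {r | ∃ X ∈ ballB d n p, r = ‖matGrad (penaltyB (n := n) (p := p)) X‖}

def Lg {d n p : ℕ} (f : Fin d → Mat n p → ℝ) : ℝ :=
  sSup {r | ∃ X ∈ ballB d n p, ∃ Y ∈ ballB d n p, X ≠ Y ∧ ∃ i,
    r = ‖dirG (f i) X - dirG (f i) Y‖ / ‖X - Y‖}

def Lb (d n p : ℕ) : ℝ :=
  sSup {r | ∃ X ∈ ballB d n p, ∃ Y ∈ ballB d n p, X ≠ Y ∧
    r = ‖matGrad (penaltyB (n := n) (p := p)) X - matGrad penaltyB Y‖ / ‖X - Y‖}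

def Lf {d n p : ℕ} (f : Fin d → Mat n p → ℝ) : ℝ :=
  sSup {r | ∃ X ∈ ballB d n p, X ≠ cubic X ∧
    r = ‖matGrad (objective f) X - matGrad (objective f) (cubic X)‖ / ‖X * (Xᵀ * X - 1)‖}

def C1 {d : ℕ} (W : Mat d d) : ℝ :=
  mixingRate W ^ 2 * (1 + mixingRate W ^ 2) / (1 - mixingRate W ^ 2)

/-- `L_g + β L_b`. -/
def Ltot {d n p : ℕ} (f : Fin d → Mat n p → ℝ) (β : ℝ) : ℝ := Lg f + β * Lb d n p

def C2 {d n p : ℕ} (f : Fin d → Mat n p → ℝ) (W : Mat d d) (β : ℝ) : ℝ :=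
  12 * (1 + mixingRate W ^ 2) * Ltot f β ^ 2 / (1 - mixingRate W ^ 2)

def rho {d n p : ℕ} (f : Fin d → Mat n p → ℝ) (W : Mat d d) (β : ℝ) : ℝ :=
  3 / (16 * C2 f W β) * (1 - mixingRate W ^ 2)

def CD {d n p : ℕ} (f : Fin d → Mat n p → ℝ) (W : Mat d d) (β : ℝ) (Xinit : Mat n p) : ℝ :=
  consensusError (fun i => dirH (f i) β Xinit) + 3 * Real.sqrt d / (1 - mixingRate W)
    + Real.sqrt d * (Mg f + β * Mb d n p)

/-- The conditions on the penalty parameter `β` and the stepsize `η`. The bounds number 5, 9 and 12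
on `η` have the factor `λ` in their denominators; they are `+∞`, that is, void, when `λ = 0`.
The bound number 11 forces `λ < 1`. -/
structure ParameterAssumption {d n p : ℕ} (f : Fin d → Mat n p → ℝ) (W : Mat d d) (β η : ℝ)
    (Xinit : Mat n p) : Prop where
  beta1 : (6 + 21 * C0 f) / 5 < β
  beta2 : 72 * (4 + 3 * Mg f) / 5 < β
  beta3 : 1 / Lb d n p < β
  beta4 : 22 * Lf f ^ 2 < β
  eta_pos : 0 < η
  eta1 : η < 216 / (49 * β ^ 2)
  eta2 : η < 12 / (7 * β)
  eta3 : η < 1 / (18 * (4 + 3 * Mg f))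
  eta4 : η < (5 * β / 72 - 4 - 3 * Mg f) / (1 + Mg f) ^ 2
  eta5 : mixingRate W ≠ 0 →
    η < Real.sqrt d * (1 - mixingRate W) / (Ltot f β * mixingRate W * CD f W β Xinit)
  eta6 : η < Real.sqrt d / (Ltot f β * CD f W β Xinit)
  eta7 : η < 1 / (8 * Ltot f β)
  eta8 : η < 1 / (4 * rho f W β * d * C2 f W β)
  eta9 : mixingRate W ≠ 0 →
    η < (1 - mixingRate W ^ 2) / (2 * mixingRate W ^ 2 * Ltot f β)
      * Real.sqrt (1 / (6 * (1 + mixingRate W ^ 2)))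
  eta10 : η < Real.sqrt (d * (1 - mixingRate W ^ 2) / (24 * Ltot f β ^ 3))
  eta11 : η < d * (1 - mixingRate W ^ 2) / (12 * Ltot f β ^ 2)
  eta12 : mixingRate W ≠ 0 →
    η < Real.sqrt (3 * rho f W β * (1 - mixingRate W ^ 2) / (16 * C1 W))

/-- The merit function `h(X̄) + ‖X̄ - X‖² + ρ ‖D̄ - D‖²` of stacked matrices `X`, `D`. -/
def merit {d n p : ℕ} (f : Fin d → Mat n p → ℝ) (W : Mat d d) (β : ℝ)
    (z : (Fin d → Mat n p) × (Fin d → Mat n p)) : ℝ :=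
  penaltyH (objective f) β (avg z.1) + consensusError z.1 ^ 2
    + rho f W β * consensusError z.2 ^ 2

/-- `min (u 0, …, u (K - 1))` for `K ≥ 1`. -/
def minUpTo (u : ℕ → ℝ) (K : ℕ) (hK : K ≠ 0) : ℝ :=
  (Finset.range K).inf' (Finset.nonempty_range_iff.mpr hK) u

end

end Destiny

namespace Destiny

variable {n p q : ℕ}

/-! ### The Frobenius inner product -/

lemma norm_sq_eq_sum (A : Mat n p) : ‖A‖ ^ 2 = ∑ i, ∑ j, A i j ^ 2 := by
  rw [Matrix.frobenius_norm_def, ← Real.sqrt_eq_rpow, Real.sq_sqrt (by positivity)]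
  simp

/-- The Frobenius inner product on matrices. -/
noncomputable instance matInnerProductSpace : InnerProductSpace ℝ (Mat n p) :=
  { Matrix.frobeniusNormedSpace with
    inner := fun A B => ∑ i, ∑ j, A i j * B i j
    norm_sq_eq_re_inner := fun A => by
      rw [norm_sq_eq_sum]
      simp [sq]
    conj_inner_symm := fun A B => by
      simp [mul_comm]
    add_left := fun A B C => by
      simp [add_mul, Finset.sum_add_distrib]
    smul_left := fun A B c => by
      simp [Finset.mul_sum, mul_assoc] }

lemma inner_eq_sum (A B : Mat n p) : inner ℝ A B = ∑ i, ∑ j, A i j * B i j := rfl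

lemma inner_eq_trace (A B : Mat n p) : inner ℝ A B = (Aᵀ * B).trace := by
  rw [inner_eq_sum, Finset.sum_comm]
  simp [Matrix.trace, Matrix.mul_apply]

lemma inner_transpose (A B : Mat n p) : inner ℝ Aᵀ Bᵀ = (inner ℝ A B : ℝ) := by
  simp only [inner_eq_sum, Matrix.transpose_apply]
  exact Finset.sum_comm

lemma inner_mul_left (A : Mat n p) (B : Mat p q) (C : Mat n q) :
    inner ℝ (A * B) C = (inner ℝ B (Aᵀ * C) : ℝ) := by
  simp [inner_eq_trace, Matrix.mul_assoc]

lemma inner_mul_right (A : Mat n p) (B : Mat p q) (C : Mat n q) :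
    inner ℝ (A * B) C = (inner ℝ A (C * Bᵀ) : ℝ) := by
  rw [inner_eq_trace, inner_eq_trace, Matrix.transpose_mul, Matrix.mul_assoc,
    Matrix.trace_mul_comm, Matrix.mul_assoc]

lemma inner_symPart_left (A D : Mat p p) (hD : Dᵀ = D) :
    inner ℝ (symPart A) D = (inner ℝ A D : ℝ) := by
  have h : inner ℝ Aᵀ D = (inner ℝ A D : ℝ) := by
    conv_lhs => rw [← hD]
    exact inner_transpose A D
  rw [symPart, real_inner_smul_left, inner_add_left, h]
  ring

/-! ### Matrices close to the Stiefel manifold -/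

/-- The infeasibility `XᵀX - I`. -/
noncomputable def gap (X : Mat n p) : Mat p p := Xᵀ * X - 1

lemma gap_transpose (X : Mat n p) : (gap X)ᵀ = gap X := by
  simp [gap]

lemma mem_regionR {X : Mat n p} : X ∈ regionR n p ↔ ‖gap X‖ ≤ 1 / 6 := Iff.rfl

lemma norm_sq_mul_left (X : Mat n p) (A : Mat p q) :
    ‖X * A‖ ^ 2 = ‖A‖ ^ 2 + inner ℝ A (gap X * A) := by
  rw [← real_inner_self_eq_norm_sq, ← real_inner_self_eq_norm_sq, inner_mul_left, gap,
    Matrix.sub_mul, inner_sub_right, Matrix.one_mul, Matrix.mul_assoc]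
  ring

lemma abs_inner_gap_mul_le (X : Mat n p) (A : Mat p q) :
    |inner ℝ A (gap X * A)| ≤ ‖gap X‖ * ‖A‖ ^ 2 := by
  calc _ ≤ ‖A‖ * ‖gap X * A‖ := abs_real_inner_le_norm _ _
    _ ≤ ‖A‖ * (‖gap X‖ * ‖A‖) := by
      gcongr
      exact Matrix.frobenius_norm_mul _ _
    _ = _ := by ring

lemma norm_sq_mul_le_of_mem {X : Mat n p} (hX : X ∈ regionR n p) (A : Mat p q) :
    ‖X * A‖ ^ 2 ≤ 7 / 6 * ‖A‖ ^ 2 := by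
  have h1 := abs_le.1 (abs_inner_gap_mul_le X A)
  have h2 := mul_le_mul_of_nonneg_right (mem_regionR.1 hX) (sq_nonneg ‖A‖)
  rw [norm_sq_mul_left]
  linarith [h1.2]

lemma le_norm_sq_mul_of_mem {X : Mat n p} (hX : X ∈ regionR n p) (A : Mat p q) :
    5 / 6 * ‖A‖ ^ 2 ≤ ‖X * A‖ ^ 2 := by
  have h1 := abs_le.1 (abs_inner_gap_mul_le X A)
  have h2 := mul_le_mul_of_nonneg_right (mem_regionR.1 hX) (sq_nonneg ‖A‖)
  rw [norm_sq_mul_left]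
  linarith [h1.1]

lemma norm_sq_transpose_mul_le_of_mem {X : Mat n p} (hX : X ∈ regionR n p) (P : Mat n q) :
    ‖Xᵀ * P‖ ^ 2 ≤ 7 / 6 * ‖P‖ ^ 2 := by
  have h1 : ‖Xᵀ * P‖ ^ 2 = inner ℝ (X * (Xᵀ * P)) P := by
    rw [← real_inner_self_eq_norm_sq, inner_mul_left, Matrix.transpose_transpose,
      real_inner_comm]
  have h2 := real_inner_le_norm (X * (Xᵀ * P)) P
  have h3 := norm_sq_mul_le_of_mem hX (Xᵀ * P)
  have h4 : (‖Xᵀ * P‖ ^ 2) ^ 2 ≤ (7 / 6 * ‖P‖ ^ 2) * ‖Xᵀ * P‖ ^ 2 := by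
    calc (‖Xᵀ * P‖ ^ 2) ^ 2 ≤ (‖X * (Xᵀ * P)‖ * ‖P‖) ^ 2 := by
          rw [h1]
          exact pow_le_pow_left₀ (h1 ▸ sq_nonneg _) h2 2
      _ = ‖X * (Xᵀ * P)‖ ^ 2 * ‖P‖ ^ 2 := by ring
      _ ≤ (7 / 6 * ‖Xᵀ * P‖ ^ 2) * ‖P‖ ^ 2 := by gcongr
      _ = _ := by ring
  rcases (sq_nonneg ‖Xᵀ * P‖).eq_or_lt with h | h
  · rw [← h]
    positivity
  · nlinarith

lemma norm_le_of_sq_le {a b : ℝ} (hb : 0 ≤ b) (h : a ^ 2 ≤ 7 / 6 * b ^ 2) : a ≤ 13 / 12 * b := by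
  refine le_of_sq_le_sq ?_ (by positivity)
  nlinarith [sq_nonneg b]

lemma norm_le_of_mem_regionR {X : Mat n p} (hX : X ∈ regionR n p) :
    ‖X‖ ^ 2 ≤ 7 * p / 6 := by
  have h := norm_sq_mul_le_of_mem hX (1 : Mat p p)
  have h1 : ‖(1 : Mat p p)‖ ^ 2 = p := by
    rw [norm_sq_eq_sum]
    simp [Matrix.one_apply]
  rw [Matrix.mul_one, h1] at h
  linarith

lemma cubic_eq (X : Mat n p) : cubic X = X + X * gap X := by
  simp [cubic, gap, Matrix.mul_sub, Matrix.mul_assoc]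

/-- The search direction as a function of the point and of the gradient at its cubic image. -/
noncomputable def searchDir (g X : Mat n p) : Mat n p :=
  (3 / 2 : ℝ) • g - (1 / 2 : ℝ) • (g * (Xᵀ * X)) - X * symPart (Xᵀ * g)

lemma dirG_eq_searchDir (φ : Mat n p → ℝ) (X : Mat n p) :
    dirG φ X = searchDir (matGrad φ (cubic X)) X := rfl

lemma dirH_eq (φ : Mat n p → ℝ) (β : ℝ) (X : Mat n p) :
    dirH φ β X = dirG φ X + β • (X * gap X) := rfl

/-- The inner product of the search direction with the gradient of the penalty is of second order
in the infeasibility. -/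
lemma inner_searchDir_mul_gap (g X : Mat n p) :
    inner ℝ (searchDir g X) (X * gap X)
      = -(3 / 2 : ℝ) * inner ℝ (Xᵀ * g) (gap X * gap X) := by
  have hS : Xᵀ * X = 1 + gap X := by simp [gap]
  set D := gap X with hD
  have hDt : Dᵀ = D := gap_transpose X
  have hDDt : (D * D)ᵀ = D * D := by rw [Matrix.transpose_mul, hDt]
  have h0 (A : Mat p p) : inner ℝ g (X * A) = (inner ℝ (Xᵀ * g) A : ℝ) := by
    rw [inner_mul_left, Matrix.transpose_transpose]
  have h2 : inner ℝ (g * (Xᵀ * X)) (X * D)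
      = inner ℝ (Xᵀ * g) D + (inner ℝ (Xᵀ * g) (D * D) : ℝ) := by
    rw [inner_mul_right, hS, Matrix.transpose_add, Matrix.transpose_one, hDt, Matrix.mul_assoc,
      Matrix.mul_add, Matrix.mul_one, Matrix.mul_add, inner_add_right, h0, h0]
  have h3 : inner ℝ (X * symPart (Xᵀ * g)) (X * D)
      = inner ℝ (Xᵀ * g) D + (inner ℝ (Xᵀ * g) (D * D) : ℝ) := by
    rw [inner_mul_left, ← Matrix.mul_assoc, hS, Matrix.add_mul, Matrix.one_mul, inner_add_right,
      inner_symPart_left _ _ hDt, inner_symPart_left _ _ hDDt]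
  rw [searchDir, inner_sub_left, inner_sub_left, real_inner_smul_left, real_inner_smul_left,
    h0, h2, h3]
  ring

lemma abs_inner_searchDir_le {X : Mat n p} (hX : X ∈ regionR n p) (g : Mat n p) :
    |inner ℝ (searchDir g X) (X * gap X)| ≤ 7 / 4 * ‖g‖ * ‖gap X‖ ^ 2 := by
  have h1 : ‖Xᵀ * g‖ ≤ 13 / 12 * ‖g‖ :=
    norm_le_of_sq_le (norm_nonneg _) (norm_sq_transpose_mul_le_of_mem hX g)
  rw [inner_searchDir_mul_gap, abs_mul]
  have h2 : |inner ℝ (Xᵀ * g) (gap X * gap X)| ≤ 13 / 12 * ‖g‖ * ‖gap X‖ ^ 2 := by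
    calc _ ≤ ‖Xᵀ * g‖ * ‖gap X * gap X‖ := abs_real_inner_le_norm _ _
      _ ≤ (13 / 12 * ‖g‖) * (‖gap X‖ * ‖gap X‖) := by
        gcongr
        exact Matrix.frobenius_norm_mul _ _
      _ = _ := by ring
  have h3 : 0 ≤ ‖g‖ * ‖gap X‖ ^ 2 := by positivity
  have h4 : |(-(3 / 2) : ℝ)| = 3 / 2 := by norm_num [abs_of_nonneg]
  rw [h4]
  linarith

/-- The lower bound for the full direction in terms of the tangential direction and the
infeasibility. -/
lemma norm_sq_add_smul_ge {X : Mat n p} (hX : X ∈ regionR n p) (g : Mat n p) {β C : ℝ}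
    (hg : ‖g‖ ≤ C) (hβ : (6 + 21 * C) / 5 < β) :
    ‖searchDir g X‖ ^ 2 + β * ‖gap X‖ ^ 2 ≤ ‖searchDir g X + β • (X * gap X)‖ ^ 2 := by
  have h1 := (abs_le.1 (abs_inner_searchDir_le hX g)).1
  have h2 := le_norm_sq_mul_of_mem hX (gap X)
  have hg0 := norm_nonneg g
  have hβ0 : 0 < β := by linarith
  rw [norm_add_sq_real, norm_smul, real_inner_smul_right, Real.norm_eq_abs, mul_pow, sq_abs]
  have h3 : ‖g‖ * ‖gap X‖ ^ 2 ≤ C * ‖gap X‖ ^ 2 := by gcongr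
  have h4 : β * (-(7 / 4 * C * ‖gap X‖ ^ 2)) ≤ β * inner ℝ (searchDir g X) (X * gap X) := by
    gcongr
    linarith
  have h5 : β ^ 2 * (5 / 6 * ‖gap X‖ ^ 2) ≤ β ^ 2 * ‖X * gap X‖ ^ 2 := by gcongr
  have h6 : 0 ≤ β * ‖gap X‖ ^ 2 * (5 / 6 * β - 7 / 2 * C - 1) := by
    apply mul_nonneg (by positivity)
    linarith
  nlinarith

/-- The region of almost feasible points is invariant under a step along `P + β X (XᵀX - I)`. -/
lemma sub_smul_mem_regionR {X : Mat n p} (hX : X ∈ regionR n p) (P : Mat n p) {β η c : ℝ}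
    (hP : ‖P‖ ≤ 1 + c) (hc : 0 ≤ c) (hβ : 72 * (4 + 3 * c) / 5 < β) (hη : 0 < η)
    (h1 : η < 216 / (49 * β ^ 2)) (h4 : η < (5 * β / 72 - 4 - 3 * c) / (1 + c) ^ 2) :
    X - η • (P + β • (X * gap X)) ∈ regionR n p := by
  have hβ0 : 0 < β := by linarith
  set D := gap X with hD
  set t := η * β with ht
  have hDt : Dᵀ = D := gap_transpose X
  have hS : Xᵀ * X = 1 + D := by simp [hD, gap]
  have ht0 : 0 < t := by positivity
  have ht1 : t ≤ 1 / 10 := by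
    have := (lt_div_iff₀ (by positivity)).1 h1
    nlinarith
  rw [mem_regionR]
  set Z := X - t • (X * D) with hZ
  have hstep : X - η • (P + β • (X * D)) = Z - η • P := by
    rw [hZ, ht, smul_add, smul_smul]
    abel
  have hZZ : Zᵀ * Z = 1 + ((1 - 2 * t) • D - (2 * t - t ^ 2) • (D * D)
      + t ^ 2 • (D * (D * D))) := by
    have e1 : Zᵀ * Z = Xᵀ * X - t • (Xᵀ * X * D) - t • (D * (Xᵀ * X))
        + t ^ 2 • (D * (Xᵀ * X) * D) := by
      rw [hZ]
      simp only [Matrix.transpose_sub, Matrix.transpose_smul, Matrix.transpose_mul, hDt,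
        Matrix.sub_mul, Matrix.mul_sub, Matrix.smul_mul, Matrix.mul_smul, smul_sub, smul_smul,
        Matrix.mul_assoc, sq]
      abel
    rw [e1, hS]
    simp only [Matrix.add_mul, Matrix.mul_add, Matrix.one_mul, Matrix.mul_one, Matrix.mul_assoc]
    module
  have hgap : gap (Z - η • P) = ((1 - 2 * t) • D - (2 * t - t ^ 2) • (D * D)
      + t ^ 2 • (D * (D * D))) - η • (Zᵀ * P + (Zᵀ * P)ᵀ) + η ^ 2 • (Pᵀ * P) := by
    have e1 : (Z - η • P)ᵀ * (Z - η • P) = Zᵀ * Z - η • (Zᵀ * P + (Zᵀ * P)ᵀ)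
        + η ^ 2 • (Pᵀ * P) := by
      simp only [Matrix.transpose_sub, Matrix.transpose_smul, Matrix.transpose_mul,
        Matrix.transpose_transpose,
        Matrix.sub_mul, Matrix.mul_sub, Matrix.smul_mul, Matrix.mul_smul, smul_sub, smul_smul,
        smul_add, sq]
      abel
    rw [gap, e1, hZZ]
    abel
  have hD6 : ‖D‖ ≤ 1 / 6 := hX
  have hD0 := norm_nonneg D
  have hDD : ‖D * D‖ ≤ 1 / 6 * ‖D‖ := (Matrix.frobenius_norm_mul D D).trans (by gcongr)
  have hDDD : ‖D * (D * D)‖ ≤ 1 / 36 * ‖D‖ :=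
    (Matrix.frobenius_norm_mul D (D * D)).trans (by nlinarith [norm_nonneg (D * D)])
  have hXP : ‖Xᵀ * P‖ ≤ 13 / 12 * (1 + c) :=
    (norm_le_of_sq_le (norm_nonneg _) (norm_sq_transpose_mul_le_of_mem hX P)).trans (by gcongr)
  have hZP : ‖Zᵀ * P‖ ≤ 5 / 4 * (1 + c) := by
    have e1 : Zᵀ * P = Xᵀ * P - t • (D * (Xᵀ * P)) := by
      rw [hZ]
      simp only [Matrix.transpose_sub, Matrix.transpose_smul, Matrix.transpose_mul, hDt,
        Matrix.sub_mul, Matrix.smul_mul, Matrix.mul_assoc]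
    have e2 : ‖D * (Xᵀ * P)‖ ≤ 1 / 6 * (13 / 12 * (1 + c)) :=
      (Matrix.frobenius_norm_mul _ _).trans (by gcongr)
    have e3 := norm_sub_le (Xᵀ * P) (t • (D * (Xᵀ * P)))
    rw [norm_smul, Real.norm_of_nonneg ht0.le] at e3
    have e4 : t * ‖D * (Xᵀ * P)‖ ≤ 1 / 10 * (1 / 6 * (13 / 12 * (1 + c))) := by gcongr
    rw [e1]
    linarith
  have hZPt : ‖(Zᵀ * P)ᵀ‖ ≤ 5 / 4 * (1 + c) := by
    rwa [Matrix.frobenius_norm_transpose]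
  have hPP : ‖Pᵀ * P‖ ≤ (1 + c) ^ 2 := by
    refine (Matrix.frobenius_norm_mul _ _).trans ?_
    rw [Matrix.frobenius_norm_transpose, ← sq]
    gcongr
  have hη4 : η * (1 + c) ^ 2 ≤ 5 * β / 72 - 4 - 3 * c :=
    ((lt_div_iff₀ (by positivity)).1 h4).le
  have b1 : ‖(1 - 2 * t) • D - (2 * t - t ^ 2) • (D * D) + t ^ 2 • (D * (D * D))‖
      ≤ (1 - 2 * t) * ‖D‖ + (2 * t - t ^ 2) * (1 / 6 * ‖D‖) + t ^ 2 * (1 / 36 * ‖D‖) := by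
    refine (norm_add_le _ _).trans ?_
    have := norm_sub_le ((1 - 2 * t) • D) ((2 * t - t ^ 2) • (D * D))
    rw [norm_smul, norm_smul, Real.norm_of_nonneg (by linarith : 0 ≤ 1 - 2 * t),
      Real.norm_of_nonneg (by nlinarith : 0 ≤ 2 * t - t ^ 2)] at this
    rw [norm_smul (t ^ 2), Real.norm_of_nonneg (sq_nonneg t)]
    have h5 : (2 * t - t ^ 2) * ‖D * D‖ ≤ (2 * t - t ^ 2) * (1 / 6 * ‖D‖) :=
      mul_le_mul_of_nonneg_left hDD (by nlinarith)
    have h6 : t ^ 2 * ‖D * (D * D)‖ ≤ t ^ 2 * (1 / 36 * ‖D‖) := by gcongr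
    linarith
  have b2 : ‖η • (Zᵀ * P + (Zᵀ * P)ᵀ)‖ ≤ η * (5 / 2 * (1 + c)) := by
    rw [norm_smul, Real.norm_of_nonneg hη.le]
    gcongr
    linarith [norm_add_le (Zᵀ * P) (Zᵀ * P)ᵀ]
  have b3 : ‖η ^ 2 • (Pᵀ * P)‖ ≤ η * (η * (1 + c) ^ 2) := by
    rw [norm_smul, Real.norm_of_nonneg (sq_nonneg η), sq, mul_assoc]
    gcongr
  rw [hstep, hgap]
  have b4 := norm_add_le (((1 - 2 * t) • D - (2 * t - t ^ 2) • (D * D)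
      + t ^ 2 • (D * (D * D))) - η • (Zᵀ * P + (Zᵀ * P)ᵀ)) (η ^ 2 • (Pᵀ * P))
  have b5 := norm_sub_le ((1 - 2 * t) • D - (2 * t - t ^ 2) • (D * D)
      + t ^ 2 • (D * (D * D))) (η • (Zᵀ * P + (Zᵀ * P)ᵀ))
  have b6 : η * (η * (1 + c) ^ 2) ≤ η * (5 * β / 72 - 4 - 3 * c) := by gcongr
  have b7 : (1 - 2 * t) * ‖D‖ + (2 * t - t ^ 2) * (1 / 6 * ‖D‖) + t ^ 2 * (1 / 36 * ‖D‖)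
      ≤ 1 / 6 - t / 4 := by
    have : (1 - 2 * t + (2 * t - t ^ 2) / 6 + t ^ 2 / 36) * ‖D‖
        ≤ (1 - 2 * t + (2 * t - t ^ 2) / 6 + t ^ 2 / 36) * (1 / 6) :=
      mul_le_mul_of_nonneg_left hD6 (by nlinarith)
    nlinarith
  have b8 : η * (5 / 2 * (1 + c)) + η * (5 * β / 72 - 4 - 3 * c) ≤ t / 4 := by
    rw [ht]
    have : 0 ≤ η * (β / 4 - (5 / 2 * (1 + c)) - (5 * β / 72 - 4 - 3 * c)) := by
      apply mul_nonneg hη.le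
      linarith
    linarith
  linarith

end Destiny

namespace Destiny

variable {d n p q : ℕ}

/-! ### Calculus with the Frobenius norm -/

/-- The topology of the Frobenius norm, which is the product topology by definition. -/
noncomputable abbrev matTopology (n p : ℕ) : TopologicalSpace (Mat n p) :=
  (inferInstance : NormedAddCommGroup (Mat n p)).toMetricSpace.toPseudoMetricSpace
    |>.toUniformSpace.toTopologicalSpace

section

attribute [local instance] matTopology

lemma inner_matGrad (φ : Mat n p → ℝ) (X V : Mat n p) :
    inner ℝ (matGrad φ X) V = fderiv ℝ φ X V := by
  conv_rhs => rw [Matrix.matrix_eq_sum_single V]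
  rw [inner_eq_sum, map_sum]
  refine Finset.sum_congr rfl fun i _ => ?_
  rw [map_sum]
  refine Finset.sum_congr rfl fun j _ => ?_
  have : Matrix.single i j (V i j) = V i j • (Matrix.single i j 1 : Mat n p) := by
    rw [Matrix.smul_single, smul_eq_mul, mul_one]
  rw [this, map_smul, smul_eq_mul, mul_comm]
  rfl

lemma matGrad_eq_of_hasFDerivAt {φ : Mat n p → ℝ} {φ' : Mat n p →L[ℝ] ℝ} {X G : Mat n p}
    (h : HasFDerivAt φ φ' X) (hG : ∀ V, φ' V = inner ℝ G V) : matGrad φ X = G := by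
  refine ext_inner_right ℝ fun V => ?_
  rw [inner_matGrad, h.fderiv, hG]

lemma isBoundedBilinearMap_matMul :
    IsBoundedBilinearMap ℝ (fun x : Mat n p × Mat p q => x.1 * x.2) where
  add_left := fun _ _ _ => Matrix.add_mul _ _ _
  smul_left := fun _ _ _ => Matrix.smul_mul _ _ _
  add_right := fun _ _ _ => Matrix.mul_add _ _ _
  smul_right := fun _ _ _ => Matrix.mul_smul _ _ _
  bound := ⟨1, one_pos, fun x y => by
    rw [one_mul]
    exact Matrix.frobenius_norm_mul x y⟩

/-- The transpose as a continuous linear map. -/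
noncomputable def transposeCLM (n p : ℕ) : Mat n p →L[ℝ] Mat p n :=
  (Matrix.transposeLinearEquiv (Fin n) (Fin p) ℝ ℝ).toLinearMap.toContinuousLinearMap

section ContDiff

variable {E : Type*} [NormedAddCommGroup E] [NormedSpace ℝ E] {k : WithTop ℕ∞}

lemma ContDiff.matMul {A : E → Mat n p} {B : E → Mat p q} (hA : ContDiff ℝ k A)
    (hB : ContDiff ℝ k B) : ContDiff ℝ k fun x => A x * B x :=
  isBoundedBilinearMap_matMul.contDiff.comp (hA.prodMk hB)

lemma ContDiff.matTranspose {A : E → Mat n p} (hA : ContDiff ℝ k A) :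
    ContDiff ℝ k fun x => (A x)ᵀ :=
  (transposeCLM n p).contDiff.comp hA

lemma hasDerivAt_matMul {A : ℝ → Mat n p} {B : ℝ → Mat p q} {A' : Mat n p} {B' : Mat p q} {t : ℝ}
    (hA : HasDerivAt A A' t) (hB : HasDerivAt B B' t) :
    HasDerivAt (fun s => A s * B s) (A t * B' + A' * B t) t := by
  have h := (isBoundedBilinearMap_matMul (n := n) (p := p) (q := q)).hasFDerivAt (A t, B t)
  exact HasFDerivAt.comp_hasDerivAt (f := fun s => (A s, B s)) t h (hA.prodMk hB)

lemma hasDerivAt_matTranspose {A : ℝ → Mat n p} {A' : Mat n p} {t : ℝ}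
    (hA : HasDerivAt A A' t) : HasDerivAt (fun s => (A s)ᵀ) A'ᵀ t :=
  ((transposeCLM n p).hasFDerivAt (x := A t)).comp_hasDerivAt t hA

end ContDiff

lemma contDiff_cubic : ContDiff ℝ 1 (cubic : Mat n p → Mat n p) :=
  ContDiff.matMul (ContDiff.matMul contDiff_id (ContDiff.matTranspose contDiff_id)) contDiff_id

lemma contDiff_gap : ContDiff ℝ 1 (gap : Mat n p → Mat p p) :=
  (ContDiff.matMul (ContDiff.matTranspose contDiff_id) contDiff_id).sub contDiff_const

lemma contDiff_mul_gap : ContDiff ℝ 1 fun X : Mat n p => X * gap X :=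
  ContDiff.matMul contDiff_id contDiff_gap

lemma contDiff_penaltyB : ContDiff ℝ 1 (penaltyB : Mat n p → ℝ) :=
  contDiff_const.mul (contDiff_gap.norm_sq ℝ)

lemma contDiff_searchDir :
    ContDiff ℝ 1 fun x : Mat n p × Mat n p => searchDir x.1 x.2 := by
  have h1 : ContDiff ℝ 1 fun x : Mat n p × Mat n p => x.1 := contDiff_fst
  have h2 : ContDiff ℝ 1 fun x : Mat n p × Mat n p => x.2 := contDiff_snd
  have h3 := ContDiff.matMul (ContDiff.matTranspose h2) h1
  exact ((h1.const_smul _).sub ((ContDiff.matMul h1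
    (ContDiff.matMul (ContDiff.matTranspose h2) h2)).const_smul _)).sub
    (ContDiff.matMul h2 ((h3.add (ContDiff.matTranspose h3)).const_smul _))

/-! ### Derivatives along curves -/

lemma hasDerivAt_cubic {Y : ℝ → Mat n p} {V : Mat n p} {t : ℝ} (hY : HasDerivAt Y V t) :
    HasDerivAt (fun s => cubic (Y s))
      (Y t * (Y t)ᵀ * V + (Y t * Vᵀ + V * (Y t)ᵀ) * Y t) t :=
  hasDerivAt_matMul (hasDerivAt_matMul hY (hasDerivAt_matTranspose hY)) hY

lemma hasDerivAt_penaltyB {Y : ℝ → Mat n p} {V : Mat n p} {t : ℝ} (hY : HasDerivAt Y V t) :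
    HasDerivAt (fun s => penaltyB (Y s)) (inner ℝ (Y t * gap (Y t)) V) t := by
  have h1 : HasDerivAt (fun s => gap (Y s)) ((Y t)ᵀ * V + Vᵀ * Y t) t :=
    (hasDerivAt_matMul (hasDerivAt_matTranspose hY) hY).sub_const 1
  have h2 := h1.norm_sq.const_mul (1 / 4 : ℝ)
  refine h2.congr_deriv ?_
  have e1 : inner ℝ (gap (Y t)) ((Y t)ᵀ * V) = (inner ℝ (Y t * gap (Y t)) V : ℝ) := by
    rw [inner_mul_left]
  have e2 : inner ℝ (gap (Y t)) (Vᵀ * Y t) = (inner ℝ (Y t * gap (Y t)) V : ℝ) := by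
    rw [← inner_transpose, gap_transpose, Matrix.transpose_mul, Matrix.transpose_transpose, e1]
  rw [inner_add_right, e1, e2]
  ring

lemma matGrad_penaltyB (X : Mat n p) : matGrad penaltyB X = X * gap X := by
  refine matGrad_eq_of_hasFDerivAt
    ((contDiff_penaltyB.differentiable one_ne_zero) X).hasFDerivAt fun V => ?_
  have hY : HasDerivAt (fun s : ℝ => X + s • V) V 0 := by
    simpa using ((hasDerivAt_id (0 : ℝ)).smul_const V).const_add X
  have hF : HasFDerivAt penaltyB (fderiv ℝ penaltyB X) (X + (0 : ℝ) • V) := by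
    rw [zero_smul, add_zero]
    exact ((contDiff_penaltyB.differentiable one_ne_zero) X).hasFDerivAt
  have h0 := HasFDerivAt.comp_hasDerivAt (f := fun s : ℝ => X + s • V) 0 hF hY
  have h := h0.unique (hasDerivAt_penaltyB hY)
  rw [h, zero_smul, add_zero]

lemma inner_cubic_deriv (g X V : Mat n p) :
    inner ℝ g (X * Xᵀ * V + (X * Vᵀ + V * Xᵀ) * X)
      = (inner ℝ (g * (Xᵀ * X) + (2 : ℝ) • (X * symPart (Xᵀ * g))) V : ℝ) := by
  have e1 : inner ℝ g (X * Xᵀ * V) = (inner ℝ (X * (Xᵀ * g)) V : ℝ) := by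
    rw [real_inner_comm, inner_mul_left, real_inner_comm]
    simp [Matrix.mul_assoc]
  have e2 : inner ℝ g (X * Vᵀ * X) = (inner ℝ (X * (Xᵀ * g)ᵀ) V : ℝ) := by
    rw [← inner_transpose g, real_inner_comm]
    simp only [Matrix.transpose_mul, Matrix.transpose_transpose]
    rw [inner_mul_left, inner_mul_right, real_inner_comm]
    simp [Matrix.mul_assoc]
  have e3 : inner ℝ g (V * Xᵀ * X) = (inner ℝ (g * (Xᵀ * X)) V : ℝ) := by
    rw [Matrix.mul_assoc, real_inner_comm, inner_mul_right, real_inner_comm]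
    simp
  have e4 : (2 : ℝ) • (X * symPart (Xᵀ * g)) = X * (Xᵀ * g) + X * (Xᵀ * g)ᵀ := by
    rw [symPart, Matrix.mul_smul, smul_smul, Matrix.mul_add]
    norm_num
  rw [e4, Matrix.add_mul, inner_add_right, inner_add_right, e1, e2, e3, inner_add_left,
    inner_add_left]
  ring

/-- The derivative of the penalty function along a curve. -/
lemma hasDerivAt_penaltyH {φ : Mat n p → ℝ} (hφ : Differentiable ℝ φ) (β : ℝ) {Y : ℝ → Mat n p}
    {V : Mat n p} {t : ℝ} (hY : HasDerivAt Y V t) :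
    HasDerivAt (fun s => penaltyH φ β (Y s))
      (inner ℝ (dirH φ β (Y t)
        + (3 / 2 : ℝ) • (matGrad φ (Y t) - matGrad φ (cubic (Y t)))) V) t := by
  have h1 := ((hφ (Y t)).hasFDerivAt.comp_hasDerivAt t hY).const_mul (3 / 2 : ℝ)
  have h2 := ((hφ (cubic (Y t))).hasFDerivAt.comp_hasDerivAt t
    (hasDerivAt_cubic hY)).const_mul (1 / 2 : ℝ)
  have h3 := (hasDerivAt_penaltyB hY).const_mul β
  refine ((h1.sub h2).add h3).congr_deriv ?_
  rw [← inner_matGrad, ← inner_matGrad, inner_cubic_deriv, dirH_eq, dirG_eq_searchDir, searchDir]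
  simp only [inner_add_left, inner_sub_left, real_inner_smul_left]
  ring

/-! ### The objective -/

lemma differentiable_objective {f : Fin d → Mat n p → ℝ} (hf : SmoothAssumption f) :
    Differentiable ℝ (objective f) :=
  (Differentiable.fun_sum fun i _ => hf.differentiable i).const_mul _

lemma matGrad_objective {f : Fin d → Mat n p → ℝ} (hf : SmoothAssumption f) (X : Mat n p) :
    matGrad (objective f) X = avg fun i => matGrad (f i) X := by
  have h : HasFDerivAt (objective f) ((1 / (d : ℝ)) • ∑ i, fderiv ℝ (f i) X) X :=
    (HasFDerivAt.fun_sum fun i _ => (hf.differentiable i X).hasFDerivAt).const_mul _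
  refine matGrad_eq_of_hasFDerivAt h fun V => ?_
  simp [avg, real_inner_smul_left, sum_inner, inner_matGrad]

lemma dirG_objective {f : Fin d → Mat n p → ℝ} (hf : SmoothAssumption f) (X : Mat n p) :
    dirG (objective f) X = avg fun i => dirG (f i) X := by
  have hlin : ∃ T : Mat n p →ₗ[ℝ] Mat n p, ∀ g, T g = searchDir g X := by
    refine ⟨IsLinearMap.mk' (fun g => searchDir g X) ⟨fun a b => ?_, fun c a => ?_⟩, fun g => rfl⟩
    · simp only [searchDir, symPart, Matrix.add_mul, Matrix.mul_add, Matrix.mul_smul,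
        Matrix.transpose_add]
      module
    · simp only [searchDir, symPart, Matrix.smul_mul, Matrix.mul_smul, Matrix.transpose_smul,
        Matrix.mul_add]
      module
  obtain ⟨T, hT⟩ := hlin
  rw [dirG_eq_searchDir, matGrad_objective hf, ← hT, avg, avg, map_smul, map_sum]
  simp only [hT, dirG_eq_searchDir]

lemma dirH_objective {f : Fin d → Mat n p → ℝ} (hf : SmoothAssumption f) (hd : d ≠ 0) (β : ℝ)
    (X : Mat n p) : dirH (objective f) β X = avg fun i => dirH (f i) β X := by
  have hd' : (d : ℝ) ≠ 0 := Nat.cast_ne_zero.2 hd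
  simp only [dirH_eq, dirG_objective hf, avg, Finset.sum_add_distrib, Finset.sum_const,
    Finset.card_univ, Fintype.card_fin, smul_add, ← Nat.cast_smul_eq_nsmul ℝ, smul_smul]
  congr 2
  field_simp

lemma locallyLipschitz_matGrad_objective {f : Fin d → Mat n p → ℝ} (hf : SmoothAssumption f) :
    LocallyLipschitz (matGrad (objective f)) := by
  have e : matGrad (objective f) = fun X => (1 / (d : ℝ)) • ∑ i, matGrad (f i) X :=
    funext fun X => matGrad_objective hf X
  have hsum (s : Finset (Fin d)) : LocallyLipschitz fun X => ∑ i ∈ s, matGrad (f i) X := by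
    classical
    induction s using Finset.induction_on with
    | empty => simpa using LocallyLipschitz.const (0 : Mat n p)
    | insert a s ha ih =>
      simp only [Finset.sum_insert ha]
      exact (hf.locallyLipschitz_grad a).add ih
  rw [e]
  exact ((contDiff_const_smul (𝕜 := ℝ) (n := 1) (1 / (d : ℝ))).locallyLipschitz).comp (hsum _)

lemma locallyLipschitz_dirG {φ : Mat n p → ℝ} (h : LocallyLipschitz (matGrad φ)) :
    LocallyLipschitz (dirG φ) := by
  have h1 : LocallyLipschitz fun X => (matGrad φ (cubic X), X) :=
    (h.comp contDiff_cubic.locallyLipschitz).prodMk LocallyLipschitz.id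
  have h2 : LocallyLipschitz fun x : Mat n p × Mat n p => searchDir x.1 x.2 :=
    contDiff_searchDir.locallyLipschitz
  have e : dirG φ = (fun x : Mat n p × Mat n p => searchDir x.1 x.2)
      ∘ fun X => (matGrad φ (cubic X), X) := rfl
  rw [e]
  exact h2.comp h1

end

end Destiny

namespace Destiny

variable {d n p : ℕ}

section

attribute [local instance] matTopology

/-! ### Averages -/

lemma avg_sub (Y Z : Fin d → Mat n p) : (avg fun i => Y i - Z i) = avg Y - avg Z := by
  simp [avg, smul_sub]

lemma avg_const (hd : d ≠ 0) (X : Mat n p) : (avg fun _ : Fin d => X) = X := by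
  have hd' : (d : ℝ) ≠ 0 := Nat.cast_ne_zero.2 hd
  simp [avg, ← Nat.cast_smul_eq_nsmul ℝ, smul_smul, hd']

lemma norm_avg_le {c : ℝ} (hc : 0 ≤ c) (Z : Fin d → Mat n p) (h : ∀ i, ‖Z i‖ ≤ c) :
    ‖avg Z‖ ≤ c := by
  rcases Nat.eq_zero_or_pos d with rfl | hd
  · simpa [avg] using hc
  · have hd' : (0 : ℝ) < d := Nat.cast_pos.2 hd
    rw [avg, norm_smul, Real.norm_of_nonneg (by positivity)]
    have h1 : ‖∑ i, Z i‖ ≤ d * c := by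
      refine (norm_sum_le _ _).trans ((Finset.sum_le_sum fun i _ => h i).trans ?_)
      simp
    calc 1 / (d : ℝ) * ‖∑ i, Z i‖ ≤ 1 / (d : ℝ) * (d * c) := by gcongr
      _ = c := by field_simp

/-! ### The regions -/

lemma ballB_eq (d n p : ℕ) :
    ballB d n p = Metric.closedBall 0 (Real.sqrt (7 * d * p / 6) + Real.sqrt d) := by
  ext X
  rw [mem_closedBall_zero_iff]
  rfl

lemma isCompact_ballB (d n p : ℕ) : IsCompact (ballB d n p) := by
  rw [ballB_eq]
  exact isCompact_closedBall _ _

lemma convex_ballB (d n p : ℕ) : Convex ℝ (ballB d n p) := by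
  rw [ballB_eq]
  exact convex_closedBall _ _

lemma isCompact_regionR (n p : ℕ) : IsCompact (regionR n p) := by
  refine (isCompact_closedBall (0 : Mat n p) (Real.sqrt (7 * p / 6))).of_isClosed_subset ?_ ?_
  · exact isClosed_le contDiff_gap.continuous.norm continuous_const
  · intro X hX
    rw [mem_closedBall_zero_iff]
    exact Real.le_sqrt_of_sq_le (norm_le_of_mem_regionR hX)

lemma mem_ballB_of_norm_sub_le (hd : d ≠ 0) {X Y : Mat n p} (hX : X ∈ regionR n p)
    (h : ‖X - Y‖ ≤ Real.sqrt d) : Y ∈ ballB d n p := by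
  have h1 : ‖X‖ ≤ Real.sqrt (7 * d * p / 6) := by
    refine Real.le_sqrt_of_sq_le ((norm_le_of_mem_regionR hX).trans ?_)
    have hd' : (1 : ℝ) ≤ d := Nat.one_le_cast.2 (Nat.one_le_iff_ne_zero.2 hd)
    have hp : (0 : ℝ) ≤ p := Nat.cast_nonneg p
    nlinarith
  have h2 : ‖Y‖ ≤ ‖X‖ + ‖X - Y‖ := norm_le_norm_add_norm_sub X Y
  exact h2.trans (add_le_add h1 h)

lemma regionR_subset_ballB (hd : d ≠ 0) : regionR n p ⊆ ballB d n p := fun X hX =>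
  mem_ballB_of_norm_sub_le hd hX (by simp)

/-! ### The constants as bounds -/

lemma exists_lipschitz_bound {g : Mat n p → Mat n p} (hg : LocallyLipschitz g)
    {S : Set (Mat n p)} (hS : IsCompact S) :
    ∃ K : ℝ, ∀ X ∈ S, ∀ Y ∈ S, ‖g X - g Y‖ ≤ K * ‖X - Y‖ := by
  obtain ⟨K, hK⟩ := (hg.locallyLipschitzOn (s := S)).exists_lipschitzOnWith_of_compact hS
  exact ⟨K, fun X hX Y hY => by simpa [dist_eq_norm] using hK.dist_le_mul X hX Y hY⟩

lemma exists_norm_bound {g : Mat n p → Mat n p} (hg : Continuous g)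
    {S : Set (Mat n p)} (hS : IsCompact S) : ∃ K : ℝ, ∀ X ∈ S, ‖g X‖ ≤ K :=
  hS.exists_bound_of_continuousOn hg.continuousOn

lemma exists_uniform_bound (u : Fin d → ℝ → Prop) (h : ∀ i, ∃ K, ∀ r, u i r → r ≤ K) :
    ∃ K, ∀ i r, u i r → r ≤ K := by
  choose K hK using h
  exact ⟨∑ i, |K i|, fun i r hr => (hK i r hr).trans ((le_abs_self _).trans
    (Finset.single_le_sum (f := fun i => |K i|) (fun j _ => abs_nonneg _) (Finset.mem_univ i)))⟩

variable {f : Fin d → Mat n p → ℝ}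

lemma norm_matGrad_le_C0 (hf : SmoothAssumption f) {X : Mat n p} (hX : X ∈ regionR n p) :
    ‖matGrad (objective f) (cubic X)‖ ≤ C0 f := by
  obtain ⟨K, hK⟩ := exists_norm_bound
    ((locallyLipschitz_matGrad_objective hf).continuous.comp contDiff_cubic.continuous)
    (isCompact_regionR n p)
  refine le_csSup ⟨K, ?_⟩ ⟨X, hX, rfl⟩
  rintro _ ⟨Y, hY, rfl⟩
  exact hK Y hY

lemma Mg_nonneg (f : Fin d → Mat n p → ℝ) : 0 ≤ Mg f :=
  Real.sSup_nonneg (by rintro _ ⟨X, -, i, rfl⟩; exact norm_nonneg _)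

lemma norm_dirG_le_Mg (hf : SmoothAssumption f) {X : Mat n p} (hX : X ∈ ballB d n p)
    (i : Fin d) : ‖dirG (f i) X‖ ≤ Mg f := by
  obtain ⟨K, hK⟩ := exists_uniform_bound (fun i r => ∃ X ∈ ballB d n p, r = ‖dirG (f i) X‖)
    fun i => by
      obtain ⟨K, hK⟩ := exists_norm_bound
        (locallyLipschitz_dirG (hf.locallyLipschitz_grad i)).continuous (isCompact_ballB d n p)
      exact ⟨K, by rintro _ ⟨Y, hY, rfl⟩; exact hK Y hY⟩
  refine le_csSup ⟨K, ?_⟩ ⟨X, hX, i, rfl⟩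
  rintro _ ⟨Y, hY, j, rfl⟩
  exact hK j _ ⟨Y, hY, rfl⟩

lemma Mb_nonneg (d n p : ℕ) : 0 ≤ Mb d n p :=
  Real.sSup_nonneg (by rintro _ ⟨X, -, rfl⟩; exact norm_nonneg _)

lemma norm_mul_gap_le_Mb {X : Mat n p} (hX : X ∈ ballB d n p) : ‖X * gap X‖ ≤ Mb d n p := by
  obtain ⟨K, hK⟩ := exists_norm_bound (contDiff_mul_gap (n := n) (p := p)).continuous
    (isCompact_ballB d n p)
  refine le_csSup ⟨K, ?_⟩ ⟨X, hX, by rw [matGrad_penaltyB]⟩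
  rintro _ ⟨Y, hY, rfl⟩
  rw [matGrad_penaltyB]
  exact hK Y hY

lemma Lg_nonneg (f : Fin d → Mat n p → ℝ) : 0 ≤ Lg f :=
  Real.sSup_nonneg (by rintro _ ⟨X, -, Y, -, -, i, rfl⟩; positivity)

lemma norm_dirG_sub_le (hf : SmoothAssumption f) {X Y : Mat n p} (hX : X ∈ ballB d n p)
    (hY : Y ∈ ballB d n p) (i : Fin d) : ‖dirG (f i) X - dirG (f i) Y‖ ≤ Lg f * ‖X - Y‖ := by
  rcases eq_or_ne X Y with rfl | hne
  · simp
  obtain ⟨K, hK⟩ := exists_uniform_bound (fun i r => ∃ X ∈ ballB d n p, ∃ Y ∈ ballB d n p,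
      X ≠ Y ∧ r = ‖dirG (f i) X - dirG (f i) Y‖ / ‖X - Y‖)
    fun i => by
      obtain ⟨K, hK⟩ := exists_lipschitz_bound
        (locallyLipschitz_dirG (hf.locallyLipschitz_grad i)) (isCompact_ballB d n p)
      refine ⟨K, ?_⟩
      rintro _ ⟨X, hX, Y, hY, hne, rfl⟩
      exact (div_le_iff₀ (norm_pos_iff.2 (sub_ne_zero.2 hne))).2 (hK X hX Y hY)
  refine (div_le_iff₀ (norm_pos_iff.2 (sub_ne_zero.2 hne))).1
    (le_csSup ⟨K, ?_⟩ ⟨X, hX, Y, hY, hne, i, rfl⟩)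
  rintro _ ⟨X, hX, Y, hY, hne, i, rfl⟩
  exact hK i _ ⟨X, hX, Y, hY, hne, rfl⟩

lemma Lb_nonneg (d n p : ℕ) : 0 ≤ Lb d n p :=
  Real.sSup_nonneg (by rintro _ ⟨X, -, Y, -, -, rfl⟩; positivity)

lemma norm_mul_gap_sub_le {X Y : Mat n p} (hX : X ∈ ballB d n p) (hY : Y ∈ ballB d n p) :
    ‖X * gap X - Y * gap Y‖ ≤ Lb d n p * ‖X - Y‖ := by
  rcases eq_or_ne X Y with rfl | hne
  · simp
  obtain ⟨K, hK⟩ := exists_lipschitz_bound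
    (contDiff_mul_gap (n := n) (p := p)).locallyLipschitz (isCompact_ballB d n p)
  refine (div_le_iff₀ (norm_pos_iff.2 (sub_ne_zero.2 hne))).1
    (le_csSup ⟨K, ?_⟩ ⟨X, hX, Y, hY, hne, by simp only [matGrad_penaltyB]⟩)
  rintro _ ⟨X, hX, Y, hY, hne, rfl⟩
  simp only [matGrad_penaltyB]
  exact (div_le_iff₀ (norm_pos_iff.2 (sub_ne_zero.2 hne))).2 (hK X hX Y hY)

lemma Lf_nonneg (f : Fin d → Mat n p → ℝ) : 0 ≤ Lf f :=
  Real.sSup_nonneg (by rintro _ ⟨X, -, -, rfl⟩; positivity)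

lemma norm_matGrad_sub_cubic_le (hf : SmoothAssumption f) {X : Mat n p}
    (hX : X ∈ ballB d n p) :
    ‖matGrad (objective f) X - matGrad (objective f) (cubic X)‖ ≤ Lf f * ‖X * gap X‖ := by
  have hsub (Y : Mat n p) : ‖Y - cubic Y‖ = ‖Y * gap Y‖ := by
    rw [cubic_eq, sub_add_cancel_left, norm_neg]
  rcases eq_or_ne X (cubic X) with h | hne
  · rw [← h, sub_self, norm_zero]
    exact mul_nonneg (Lf_nonneg f) (norm_nonneg _)
  have hpos {Y : Mat n p} (h : Y ≠ cubic Y) : 0 < ‖Y * gap Y‖ := by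
    rw [← hsub]
    exact norm_pos_iff.2 (sub_ne_zero.2 h)
  have hc : IsCompact (ballB d n p ∪ cubic '' ballB d n p) :=
    (isCompact_ballB d n p).union ((isCompact_ballB d n p).image contDiff_cubic.continuous)
  obtain ⟨K, hK⟩ := exists_lipschitz_bound (locallyLipschitz_matGrad_objective hf) hc
  refine (div_le_iff₀ (hpos hne)).1 (le_csSup ⟨K, ?_⟩ ⟨X, hX, hne, rfl⟩)
  rintro _ ⟨Y, hY, hY', rfl⟩
  refine (div_le_iff₀ (hpos hY')).2 ?_
  rw [← hsub]
  exact hK Y (Or.inl hY) _ (Or.inr ⟨Y, hY, rfl⟩)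

lemma norm_dirH_sub_le (hf : SmoothAssumption f) {β : ℝ} (hβ : 0 ≤ β) {X Y : Mat n p}
    (hX : X ∈ ballB d n p) (hY : Y ∈ ballB d n p) (i : Fin d) :
    ‖dirH (f i) β X - dirH (f i) β Y‖ ≤ Ltot f β * ‖X - Y‖ := by
  have e : dirH (f i) β X - dirH (f i) β Y
      = (dirG (f i) X - dirG (f i) Y) + β • (X * gap X - Y * gap Y) := by
    rw [dirH_eq, dirH_eq, smul_sub]
    abel
  have h1 := norm_dirG_sub_le hf hX hY i
  have h2 := mul_le_mul_of_nonneg_left (norm_mul_gap_sub_le hX hY) hβ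
  rw [e, Ltot]
  refine (norm_add_le _ _).trans ?_
  rw [norm_smul, Real.norm_of_nonneg hβ]
  linarith

lemma norm_dirH_le (hf : SmoothAssumption f) {β : ℝ} (hβ : 0 ≤ β) {X : Mat n p}
    (hX : X ∈ ballB d n p) (i : Fin d) : ‖dirH (f i) β X‖ ≤ Mg f + β * Mb d n p := by
  rw [dirH_eq]
  refine (norm_add_le _ _).trans ?_
  rw [norm_smul, Real.norm_of_nonneg hβ]
  have h2 := mul_le_mul_of_nonneg_left (norm_mul_gap_le_Mb hX) hβ
  linarith [norm_dirG_le_Mg hf hX i]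

lemma Ltot_nonneg (f : Fin d → Mat n p → ℝ) {β : ℝ} (hβ : 0 ≤ β) : 0 ≤ Ltot f β :=
  add_nonneg (Lg_nonneg f) (mul_nonneg hβ (Lb_nonneg d n p))

lemma norm_dirH_objective_sub_le (hf : SmoothAssumption f) (hd : d ≠ 0) {β : ℝ} (hβ : 0 ≤ β)
    {X Y : Mat n p} (hX : X ∈ ballB d n p) (hY : Y ∈ ballB d n p) :
    ‖dirH (objective f) β X - dirH (objective f) β Y‖ ≤ Ltot f β * ‖X - Y‖ := by
  rw [dirH_objective hf hd, dirH_objective hf hd, ← avg_sub]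
  exact norm_avg_le (mul_nonneg (Ltot_nonneg f hβ) (norm_nonneg _)) _
    fun i => norm_dirH_sub_le hf hβ hX hY i

lemma norm_dirG_objective_le (hf : SmoothAssumption f) {X : Mat n p} (hX : X ∈ ballB d n p) :
    ‖dirG (objective f) X‖ ≤ Mg f := by
  rw [dirG_objective hf]
  exact norm_avg_le (Mg_nonneg f) _ fun i => norm_dirG_le_Mg hf hX i

/-! ### Descent of the penalty function -/

/-- Second order upper bound from a linear upper bound of the derivative on `[0, 1]`. -/
lemma le_of_hasDerivAt_le {u u' : ℝ → ℝ} {a c : ℝ} (hu : ∀ t, HasDerivAt u (u' t) t)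
    (h : ∀ t ∈ Set.Ioo (0 : ℝ) 1, u' t ≤ a + c * t) : u 1 ≤ u 0 + a + c / 2 := by
  have hv (t : ℝ) : HasDerivAt (fun s => u s - (a * s + c / 2 * s ^ 2)) (u' t - (a + c * t)) t := by
    have h1 := ((hasDerivAt_id t).const_mul a).add (((hasDerivAt_id t).pow 2).const_mul (c / 2))
    refine ((hu t).sub h1).congr_deriv ?_
    simp
    ring
  have hanti : AntitoneOn (fun s => u s - (a * s + c / 2 * s ^ 2)) (Set.Icc 0 1) := by
    refine antitoneOn_of_deriv_nonpos (convex_Icc 0 1)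
      (fun t _ => (hv t).continuousAt.continuousWithinAt)
      (fun t _ => (hv t).differentiableAt.differentiableWithinAt) fun t ht => ?_
    rw [interior_Icc] at ht
    rw [(hv t).deriv]
    linarith [h t ht]
  have := hanti (Set.left_mem_Icc.2 zero_le_one) (Set.right_mem_Icc.2 zero_le_one) zero_le_one
  simp only at this
  linarith

lemma penaltyH_le (hf : SmoothAssumption f) (hd : d ≠ 0) {β : ℝ} (hβ : 0 ≤ β)
    {X V : Mat n p} (hX : X ∈ ballB d n p) (hY : X + V ∈ ballB d n p) :
    penaltyH (objective f) β (X + V) ≤ penaltyH (objective f) β X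
      + inner ℝ (dirH (objective f) β X) V + 3 / 2 * Lf f * ‖X * gap X‖ * ‖V‖
      + (Ltot f β + 3 / 2 * Lf f * Lb d n p) / 2 * ‖V‖ ^ 2 := by
  set Y : ℝ → Mat n p := fun t => X + t • V with hYdef
  have hYd (t : ℝ) : HasDerivAt Y V t := by
    have h := ((hasDerivAt_id t).smul_const V).const_add X
    rwa [one_smul] at h
  have hmem {t : ℝ} (ht : t ∈ Set.Ioo (0 : ℝ) 1) : Y t ∈ ballB d n p := by
    have := (convex_ballB d n p).add_smul_sub_mem hX hY ⟨ht.1.le, ht.2.le⟩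
    simpa [hYdef] using this
  have key := le_of_hasDerivAt_le
    (a := inner ℝ (dirH (objective f) β X) V + 3 / 2 * Lf f * ‖X * gap X‖ * ‖V‖)
    (c := (Ltot f β + 3 / 2 * Lf f * Lb d n p) * ‖V‖ ^ 2)
    (fun t => hasDerivAt_penaltyH (differentiable_objective hf) β (hYd t)) fun t ht => by
      have hYt := hmem ht
      have hdist : ‖Y t - X‖ = t * ‖V‖ := by
        rw [hYdef, add_sub_cancel_left, norm_smul, Real.norm_of_nonneg ht.1.le]
      have h1 : inner ℝ (dirH (objective f) β (Y t)) V
          ≤ inner ℝ (dirH (objective f) β X) V + Ltot f β * (t * ‖V‖) * ‖V‖ := by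
        have e := real_inner_le_norm (dirH (objective f) β (Y t) - dirH (objective f) β X) V
        rw [inner_sub_left] at e
        have e2 := mul_le_mul_of_nonneg_right
          (norm_dirH_objective_sub_le hf hd hβ hYt hX) (norm_nonneg V)
        rw [hdist] at e2
        linarith
      have h2 : inner ℝ (matGrad (objective f) (Y t) - matGrad (objective f) (cubic (Y t))) V
          ≤ Lf f * (‖X * gap X‖ + Lb d n p * (t * ‖V‖)) * ‖V‖ := by
        refine (real_inner_le_norm _ _).trans ?_
        gcongr
        refine (norm_matGrad_sub_cubic_le hf hYt).trans ?_
        have e1 := norm_mul_gap_sub_le hYt hX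
        rw [hdist] at e1
        have e2 := norm_le_norm_add_norm_sub (X * gap X) (Y t * gap (Y t))
        rw [norm_sub_rev] at e2
        gcongr
        · exact Lf_nonneg f
        · linarith
      rw [inner_add_left, real_inner_smul_left]
      linarith
  have e0 : Y 0 = X := by simp [hYdef]
  have e1 : Y 1 = X + V := by simp [hYdef]
  simp only [e0, e1] at key
  linarith

end

end Destiny

namespace Destiny

variable {d n p : ℕ}

section

attribute [local instance] matTopology

/-! ### Stacked matrices -/

lemma stackNorm_eq_norm (Z : Fin d → Mat n p) : stackNorm Z = ‖WithLp.toLp 2 Z‖ := by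
  rw [PiLp.norm_eq_of_L2]
  rfl

lemma stackNorm_nonneg (Z : Fin d → Mat n p) : 0 ≤ stackNorm Z := Real.sqrt_nonneg _

lemma stackNorm_sq (Z : Fin d → Mat n p) : stackNorm Z ^ 2 = ∑ i, ‖Z i‖ ^ 2 :=
  Real.sq_sqrt (Finset.sum_nonneg fun _ _ => sq_nonneg _)

lemma stackNorm_add_le (Y Z : Fin d → Mat n p) :
    stackNorm (fun i => Y i + Z i) ≤ stackNorm Y + stackNorm Z := by
  simp only [stackNorm_eq_norm]
  exact norm_add_le (WithLp.toLp 2 Y) (WithLp.toLp 2 Z)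

lemma stackNorm_sub_le (Y Z : Fin d → Mat n p) :
    stackNorm (fun i => Y i - Z i) ≤ stackNorm Y + stackNorm Z := by
  simp only [stackNorm_eq_norm]
  exact norm_sub_le (WithLp.toLp 2 Y) (WithLp.toLp 2 Z)

lemma stackNorm_smul {c : ℝ} (hc : 0 ≤ c) (Z : Fin d → Mat n p) :
    stackNorm (fun i => c • Z i) = c * stackNorm Z := by
  have h : stackNorm (fun i => c • Z i) ^ 2 = (c * stackNorm Z) ^ 2 := by
    rw [mul_pow, stackNorm_sq, stackNorm_sq, Finset.mul_sum]
    exact Finset.sum_congr rfl fun i _ => by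
      rw [norm_smul, mul_pow, Real.norm_of_nonneg hc]
  exact (pow_left_inj₀ (stackNorm_nonneg _) (mul_nonneg hc (stackNorm_nonneg _))
    two_ne_zero).1 h

lemma stackNorm_const (X : Mat n p) :
    stackNorm (fun _ : Fin d => X) = Real.sqrt d * ‖X‖ := by
  rw [stackNorm, Finset.sum_const, Finset.card_univ, Fintype.card_fin, nsmul_eq_mul,
    Real.sqrt_mul (Nat.cast_nonneg d), Real.sqrt_sq (norm_nonneg X)]

lemma norm_le_stackNorm (Z : Fin d → Mat n p) (i : Fin d) : ‖Z i‖ ≤ stackNorm Z := by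
  refine Real.le_sqrt_of_sq_le ?_
  exact Finset.single_le_sum (f := fun i => ‖Z i‖ ^ 2) (fun _ _ => sq_nonneg _)
    (Finset.mem_univ i)

lemma stackNorm_le_mul {Y Z : Fin d → Mat n p} {c : ℝ} (hc : 0 ≤ c)
    (h : ∀ i, ‖Y i‖ ≤ c * ‖Z i‖) : stackNorm Y ≤ c * stackNorm Z := by
  refine le_of_sq_le_sq ?_ (mul_nonneg hc (stackNorm_nonneg _))
  rw [mul_pow, stackNorm_sq, stackNorm_sq, Finset.mul_sum]
  refine Finset.sum_le_sum fun i _ => ?_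
  rw [← mul_pow]
  exact pow_le_pow_left₀ (norm_nonneg _) (h i) 2

lemma sqrt_mul_norm_avg_le (hd : d ≠ 0) (Z : Fin d → Mat n p) :
    Real.sqrt d * ‖avg Z‖ ≤ stackNorm Z := by
  have hd' : (0 : ℝ) < d := Nat.cast_pos.2 (Nat.pos_of_ne_zero hd)
  refine le_of_sq_le_sq ?_ (stackNorm_nonneg _)
  rw [mul_pow, Real.sq_sqrt hd'.le, stackNorm_sq, avg, norm_smul,
    Real.norm_of_nonneg (by positivity)]
  have h1 : ‖∑ i, Z i‖ ^ 2 ≤ d * ∑ i, ‖Z i‖ ^ 2 := by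
    have h2 := sq_sum_le_card_mul_sum_sq (s := Finset.univ) (f := fun i => ‖Z i‖)
    rw [Finset.card_univ, Fintype.card_fin] at h2
    exact (pow_le_pow_left₀ (norm_nonneg _) (norm_sum_le _ _) 2).trans h2
  calc (d : ℝ) * (1 / d * ‖∑ i, Z i‖) ^ 2 = 1 / d * ‖∑ i, Z i‖ ^ 2 := by
        field_simp
    _ ≤ 1 / d * (d * ∑ i, ‖Z i‖ ^ 2) := by gcongr
    _ = ∑ i, ‖Z i‖ ^ 2 := by field_simp

lemma consensusError_nonneg (Z : Fin d → Mat n p) : 0 ≤ consensusError Z := stackNorm_nonneg _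

lemma consensusError_le_stackNorm (hd : d ≠ 0) (Z : Fin d → Mat n p) :
    consensusError Z ≤ stackNorm Z := by
  have hd' : (d : ℝ) ≠ 0 := Nat.cast_ne_zero.2 hd
  refine le_of_sq_le_sq ?_ (stackNorm_nonneg _)
  rw [consensusError, stackNorm_sq, stackNorm_sq]
  have hsum : ∑ i, Z i = (d : ℝ) • avg Z := by
    rw [avg, smul_smul, mul_one_div_cancel hd', one_smul]
  have h1 : ∑ i, ‖avg Z - Z i‖ ^ 2 = ∑ i, ‖Z i‖ ^ 2 - d * ‖avg Z‖ ^ 2 := by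
    simp only [norm_sub_sq_real, Finset.sum_add_distrib, Finset.sum_sub_distrib,
      ← Finset.mul_sum, ← inner_sum, hsum, inner_smul_right, real_inner_self_eq_norm_sq]
    simp
    ring
  rw [h1]
  have : 0 ≤ (d : ℝ) * ‖avg Z‖ ^ 2 := by positivity
  linarith

lemma consensusError_add_le (Y Z : Fin d → Mat n p) :
    consensusError (fun i => Y i + Z i) ≤ consensusError Y + consensusError Z := by
  have e : (fun i => (avg fun i => Y i + Z i) - (Y i + Z i))
      = fun i => (avg Y - Y i) + (avg Z - Z i) := by
    funext i
    simp only [avg, Finset.sum_add_distrib, smul_add]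
    abel
  rw [consensusError, e]
  exact stackNorm_add_le _ _

lemma consensusError_const (hd : d ≠ 0) (X : Mat n p) :
    consensusError (fun _ : Fin d => X) = 0 := by
  rw [consensusError, avg_const hd]
  simp [stackNorm]

lemma stackNorm_sub_avg (Z : Fin d → Mat n p) :
    stackNorm (fun i => Z i - avg Z) = consensusError Z := by
  rw [consensusError, stackNorm, stackNorm]
  simp only [norm_sub_rev]

/-! ### Mixing -/

/-- The action of a mixing matrix on the blocks of a stacked matrix. -/
noncomputable def mix (A : Mat d d) (Z : Fin d → Mat n p) : Fin d → Mat n p :=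
  fun i => ∑ j, A i j • Z j

lemma stackNorm_mix_le (A : Mat d d) (Z : Fin d → Mat n p) :
    stackNorm (mix A Z) ≤ ‖Matrix.toEuclideanCLM (n := Fin d) (𝕜 := ℝ) A‖ * stackNorm Z := by
  set c := ‖Matrix.toEuclideanCLM (n := Fin d) (𝕜 := ℝ) A‖ with hc
  have hc0 : 0 ≤ c := norm_nonneg _
  refine le_of_sq_le_sq ?_ (mul_nonneg hc0 (stackNorm_nonneg _))
  have hsq (Y : Fin d → Mat n p) :
      stackNorm Y ^ 2 = ∑ a, ∑ b, ‖WithLp.toLp 2 (fun i => Y i a b)‖ ^ 2 := by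
    rw [stackNorm_sq]
    simp only [norm_sq_eq_sum, EuclideanSpace.norm_sq_eq, Real.norm_eq_abs, sq_abs]
    rw [Finset.sum_comm]
    exact Finset.sum_congr rfl fun a _ => Finset.sum_comm
  rw [mul_pow, hsq, hsq, Finset.mul_sum]
  refine Finset.sum_le_sum fun a _ => ?_
  rw [Finset.mul_sum]
  refine Finset.sum_le_sum fun b _ => ?_
  have h := (Matrix.toEuclideanCLM (n := Fin d) (𝕜 := ℝ) A).le_opNorm
    (WithLp.toLp 2 (fun i => Z i a b))
  have e : Matrix.toEuclideanCLM (n := Fin d) (𝕜 := ℝ) A (WithLp.toLp 2 (fun i => Z i a b))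
      = WithLp.toLp 2 (fun i => mix A Z i a b) := by
    rw [Matrix.toEuclideanCLM_toLp]
    congr 1
    funext i
    simp [mix, Matrix.mulVec, dotProduct, Matrix.sum_apply]
  rw [e] at h
  rw [← mul_pow]
  exact pow_le_pow_left₀ (norm_nonneg _) h 2

section Mixing

variable {𝒢 : SimpleGraph (Fin d)} {W : Mat d d}

lemma MixingAssumption.sum_row (hW : MixingAssumption 𝒢 W) (i : Fin d) : ∑ j, W i j = 1 := by
  have := congrFun hW.row_sum i
  simpa [Matrix.mulVec, dotProduct] using this

lemma MixingAssumption.sum_col (hW : MixingAssumption 𝒢 W) (j : Fin d) : ∑ i, W i j = 1 := by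
  have := congrFun hW.col_sum j
  simpa [Matrix.mulVec, dotProduct] using this

lemma avg_mix (hW : MixingAssumption 𝒢 W) (Z : Fin d → Mat n p) : avg (mix W Z) = avg Z := by
  simp only [avg, mix]
  rw [Finset.sum_comm]
  simp only [← Finset.sum_smul, hW.sum_col, one_smul]

lemma mix_sub_avg (hd : d ≠ 0) (hW : MixingAssumption 𝒢 W) (Z : Fin d → Mat n p) (i : Fin d) :
    mix W Z i - avg Z
      = mix (W - Matrix.of fun _ _ => 1 / (d : ℝ)) (fun j => Z j - avg Z) i := by
  have hd' : (d : ℝ) ≠ 0 := Nat.cast_ne_zero.2 hd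
  simp only [mix, Matrix.sub_apply, Matrix.of_apply, sub_smul, smul_sub, Finset.sum_sub_distrib,
    ← Finset.sum_smul, hW.sum_row, one_smul, ← Finset.smul_sum]
  rw [Finset.sum_const, Finset.card_univ, Fintype.card_fin, ← Nat.cast_smul_eq_nsmul ℝ, smul_eq_mul,
    mul_one_div_cancel hd', one_smul]
  change _ = _ - avg Z - (avg Z - avg Z)
  abel

/-- Mixing contracts the consensus error. -/
lemma consensusError_mix_le (hd : d ≠ 0) (hW : MixingAssumption 𝒢 W) (Z : Fin d → Mat n p) :
    consensusError (mix W Z) ≤ mixingRate W * consensusError Z := by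
  rw [← stackNorm_sub_avg, ← stackNorm_sub_avg, avg_mix hW]
  simp only [mix_sub_avg hd hW]
  exact stackNorm_mix_le _ _

lemma mixingRate_nonneg (W : Mat d d) : 0 ≤ mixingRate W := norm_nonneg _

end Mixing

end

end Destiny

namespace Destiny

variable {d n p : ℕ}

section

attribute [local instance] matTopology

variable {f : Fin d → Mat n p → ℝ} {W : Mat d d} {β η : ℝ} {Xinit : Mat n p}

/-! ### Consequences of the conditions on the parameters -/

/-- A vanishing Lipschitz constant of the gradient of the penalty is possible only for matrices
of size zero. -/
lemma subsingleton_of_Lb_eq_zero (hd : d ≠ 0) (h : Lb d n p = 0) : Subsingleton (Mat n p) := by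
  have hd1 : 1 ≤ Real.sqrt d :=
    Real.one_le_sqrt.2 (Nat.one_le_cast.2 (Nat.one_le_iff_ne_zero.2 hd))
  have hball {Y : Mat n p} (hY : ‖Y‖ ≤ 1 / 2) : Y ∈ ballB d n p := by
    have : 0 ≤ Real.sqrt (7 * d * p / 6) := Real.sqrt_nonneg _
    change ‖Y‖ ≤ _
    linarith
  have hsmall (Y : Mat n p) (hY : ‖Y‖ ≤ 1 / 2) : Y = 0 := by
    have h1 := norm_mul_gap_sub_le (d := d) (hball hY) (hball (Y := (0 : Mat n p)) (by simp))
    rw [h, zero_mul, Matrix.zero_mul, sub_zero] at h1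
    have h2 : Y * gap Y = 0 := norm_le_zero_iff.1 h1
    have h3 : Y * Yᵀ * Y = Y := by
      change cubic Y = Y
      rw [cubic_eq, h2, add_zero]
    have h4 : ‖Y‖ ≤ ‖Y‖ * ‖Y‖ * ‖Y‖ := by
      conv_lhs => rw [← h3]
      refine (Matrix.frobenius_norm_mul _ _).trans ?_
      gcongr
      refine (Matrix.frobenius_norm_mul _ _).trans ?_
      rw [Matrix.frobenius_norm_transpose]
    have h5 : ‖Y‖ ≤ 0 := by nlinarith [norm_nonneg Y]
    exact norm_le_zero_iff.1 h5
  have hzero (Y : Mat n p) : Y = 0 := by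
    by_contra hne
    have hpos : 0 < ‖Y‖ := norm_pos_iff.2 hne
    have h1 : (1 / (2 * ‖Y‖)) • Y = 0 := by
      refine hsmall _ (le_of_eq ?_)
      rw [norm_smul, Real.norm_of_nonneg (by positivity)]
      field_simp
    rcases smul_eq_zero.1 h1 with h2 | h2
    · have : 0 < 1 / (2 * ‖Y‖) := by positivity
      exact this.ne' h2
    · exact hne h2
  exact ⟨fun A B => (hzero A).trans (hzero B).symm⟩

lemma pos_of_one_div_pos_of_lt {a b : ℝ} (ha : 0 < a) (h : a < 1 / b) : 0 < b :=
  one_div_pos.1 (ha.trans h)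

namespace ParameterAssumption

lemma beta_large (h : ParameterAssumption f W β η Xinit) : 288 / 5 < β := by
  have := h.beta2
  linarith [Mg_nonneg f]

lemma beta_pos (h : ParameterAssumption f W β η Xinit) : 0 < β := by
  linarith [h.beta_large]

lemma Ltot_pos (h : ParameterAssumption f W β η Xinit) : 0 < Ltot f β := by
  have := pos_of_one_div_pos_of_lt h.eta_pos h.eta7
  linarith

lemma one_lt_Ltot (h : ParameterAssumption f W β η Xinit) (hd : d ≠ 0) : 1 < Ltot f β := by
  have hLb : 0 < Lb d n p := by
    refine (Lb_nonneg d n p).lt_of_ne fun h0 => ?_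
    have := subsingleton_of_Lb_eq_zero hd h0.symm
    have hLg : Lg f = 0 := by
      have : {r | ∃ X ∈ ballB d n p, ∃ Y ∈ ballB d n p, X ≠ Y ∧ ∃ i,
          r = ‖dirG (f i) X - dirG (f i) Y‖ / ‖X - Y‖} = ∅ := by
        refine Set.eq_empty_of_forall_notMem ?_
        rintro _ ⟨X, -, Y, -, hne, -⟩
        exact hne (Subsingleton.elim X Y)
      rw [Lg, this, Real.sSup_empty]
    have hL := h.Ltot_pos
    rw [Ltot, hLg, ← h0] at hL
    simp at hL
  have h3 := (div_lt_iff₀ hLb).1 h.beta3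
  rw [Ltot]
  linarith [Lg_nonneg f]

lemma one_sub_sq_pos (h : ParameterAssumption f W β η Xinit) :
    0 < 1 - mixingRate W ^ 2 := by
  have h1 := h.eta_pos.trans h.eta11
  have hL : 0 < 12 * Ltot f β ^ 2 := by
    have := h.Ltot_pos
    positivity
  have h2 := (div_pos_iff_of_pos_right hL).1 h1
  exact pos_of_mul_pos_right h2 (Nat.cast_nonneg d)

lemma rate_lt_one (h : ParameterAssumption f W β η Xinit) : mixingRate W < 1 := by
  have := h.one_sub_sq_pos
  have h0 := mixingRate_nonneg W
  nlinarith

lemma CD_nonneg (h : ParameterAssumption f W β η Xinit) : 0 ≤ CD f W β Xinit := by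
  have h1 := h.rate_lt_one
  have h2 := Mg_nonneg f
  have h3 := Mb_nonneg d n p
  have h4 := h.beta_pos
  have h5 : 0 < 1 - mixingRate W := by linarith
  have h6 := consensusError_nonneg fun i => dirH (f i) β Xinit
  rw [CD]
  positivity

lemma eta_mul_CD_le (h : ParameterAssumption f W β η Xinit) :
    Ltot f β * (η * CD f W β Xinit) ≤ Real.sqrt d := by
  have h1 := h.eta6
  rcases (mul_nonneg h.Ltot_pos.le h.CD_nonneg).eq_or_lt with h0 | h0
  · rw [← h0, div_zero] at h1
    exact absurd h.eta_pos (by linarith)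
  · have := (lt_div_iff₀ h0).1 h1
    linarith

lemma eta_mul_rate_mul_CD_le (h : ParameterAssumption f W β η Xinit) :
    Ltot f β * (mixingRate W * (η * CD f W β Xinit)) ≤ Real.sqrt d * (1 - mixingRate W) := by
  have hr := h.rate_lt_one
  have hs := Real.sqrt_nonneg (d : ℝ)
  by_cases h0 : mixingRate W = 0
  · rw [h0]
    simp
  have h1 := h.eta5 h0
  have hpos : 0 ≤ Ltot f β * mixingRate W * CD f W β Xinit :=
    mul_nonneg (mul_nonneg h.Ltot_pos.le (mixingRate_nonneg W)) h.CD_nonneg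
  rcases hpos.eq_or_lt with h2 | h2
  · rw [← h2, div_zero] at h1
    exact absurd h.eta_pos (by linarith)
  · have := (lt_div_iff₀ h2).1 h1
    linarith

lemma C2_pos (h : ParameterAssumption f W β η Xinit) : 0 < C2 f W β := by
  have h1 := h.one_sub_sq_pos
  have h2 := h.Ltot_pos
  rw [C2]
  positivity

lemma rho_pos (h : ParameterAssumption f W β η Xinit) : 0 < rho f W β := by
  have h1 := h.one_sub_sq_pos
  have h2 := h.C2_pos
  rw [rho]
  positivity

lemma rho_mul_C2 (h : ParameterAssumption f W β η Xinit) :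
    rho f W β * C2 f W β = 3 / 16 * (1 - mixingRate W ^ 2) := by
  have h2 := h.C2_pos.ne'
  rw [rho]
  field_simp

lemma eta_mul_Ltot_le (h : ParameterAssumption f W β η Xinit) : η * Ltot f β ≤ 1 / 8 := by
  have h1 := (lt_div_iff₀ (by linarith [h.Ltot_pos] : 0 < 8 * Ltot f β)).1 h.eta7
  linarith

lemma eta_mul_Ltot_sq_le (h : ParameterAssumption f W β η Xinit) (hd : d ≠ 0) :
    η * (Ltot f β ^ 2 / d) ≤ (1 - mixingRate W ^ 2) / 12 := by
  have hd' : (0 : ℝ) < d := Nat.cast_pos.2 (Nat.pos_of_ne_zero hd)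
  have hL := h.Ltot_pos
  have h1 := (lt_div_iff₀ (by positivity : 0 < 12 * Ltot f β ^ 2)).1 h.eta11
  rw [← mul_div_assoc, div_le_iff₀ hd']
  linarith

lemma eta_mul_rho_le (h : ParameterAssumption f W β η Xinit) (hd : d ≠ 0) :
    rho f W β * C2 f W β * (η * d) ≤ 1 / 4 := by
  have hd' : (0 : ℝ) < d := Nat.cast_pos.2 (Nat.pos_of_ne_zero hd)
  have h2 := h.C2_pos
  have h3 := h.rho_pos
  have h1 := (lt_div_iff₀ (by positivity : 0 < 4 * rho f W β * d * C2 f W β)).1 h.eta8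
  linarith

lemma eta_sq_mul_C1_le (h : ParameterAssumption f W β η Xinit) :
    η ^ 2 * C1 W ≤ 3 / 16 * rho f W β * (1 - mixingRate W ^ 2) := by
  have h1 := h.one_sub_sq_pos
  have h3 := h.rho_pos
  by_cases h0 : mixingRate W = 0
  · rw [C1, h0]
    rw [h0] at h1
    norm_num
    exact h3.le
  have hC : 0 < C1 W := by
    rw [C1]
    positivity
  have h4 := (Real.lt_sqrt h.eta_pos.le).1 (h.eta12 h0)
  have h5 := (lt_div_iff₀ (by positivity)).1 h4
  linarith

lemma eta_sq_mul_rate_sq_le (h : ParameterAssumption f W β η Xinit) :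
    η ^ 2 * mixingRate W ^ 2 ≤ 3 / 16 * rho f W β := by
  have h1 := h.one_sub_sq_pos
  have h3 := h.rho_pos
  have h4 := h.eta_sq_mul_C1_le
  have hle : mixingRate W ^ 2 ≤ C1 W := by
    rw [C1, le_div_iff₀ h1]
    nlinarith [sq_nonneg (mixingRate W)]
  have h5 : η ^ 2 * mixingRate W ^ 2 ≤ η ^ 2 * C1 W := by gcongr
  have h6 : 3 / 16 * rho f W β * (1 - mixingRate W ^ 2) ≤ 3 / 16 * rho f W β * 1 := by
    gcongr
    linarith [sq_nonneg (mixingRate W)]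
  linarith

lemma Lf_le (h : ParameterAssumption f W β η Xinit) : Lf f ≤ β / 30 := by
  have hβ := h.beta_large
  refine le_of_sq_le_sq ?_ (by linarith)
  nlinarith [h.beta4]

end ParameterAssumption

/-! ### One iteration -/

lemma iter_succ_fst (f : Fin d → Mat n p → ℝ) (W : Mat d d) (β η : ℝ) (Xinit : Mat n p) (k : ℕ) :
    (iter f W β η Xinit (k + 1)).1
      = mix W fun i => (iter f W β η Xinit k).1 i - η • (iter f W β η Xinit k).2 i := rfl

lemma iter_succ_snd (f : Fin d → Mat n p → ℝ) (W : Mat d d) (β η : ℝ) (Xinit : Mat n p) (k : ℕ) :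
    (iter f W β η Xinit (k + 1)).2
      = fun i => mix W (iter f W β η Xinit k).2 i
        + (dirH (f i) β ((iter f W β η Xinit (k + 1)).1 i)
          - dirH (f i) β ((iter f W β η Xinit k).1 i)) := by
  funext i
  rw [← add_sub_assoc]
  rfl

/-- The invariants of the iteration: the average of the local variables is almost feasible, the
consensus errors are bounded, and the directions track the average direction. -/
structure Invariant (f : Fin d → Mat n p → ℝ) (W : Mat d d) (β : ℝ) (Xinit : Mat n p)
    (z : (Fin d → Mat n p) × (Fin d → Mat n p)) : Prop where
  avg_mem : avg z.1 ∈ regionR n p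
  consensus_fst : Ltot f β * consensusError z.1 ≤ Real.sqrt d
  consensus_snd : consensusError z.2
    ≤ consensusError (fun i => dirH (f i) β Xinit) + 3 * Real.sqrt d / (1 - mixingRate W)
  tracking : avg z.2 = avg fun i => dirH (f i) β (z.1 i)

section Step

variable {𝒢 : SimpleGraph (Fin d)} {z : (Fin d → Mat n p) × (Fin d → Mat n p)}

lemma Invariant.consensus_fst_le (hz : Invariant f W β Xinit z)
    (hpar : ParameterAssumption f W β η Xinit) (hd : d ≠ 0) :
    consensusError z.1 ≤ Real.sqrt d := by
  nlinarith [hz.consensus_fst, hpar.one_lt_Ltot hd, consensusError_nonneg z.1]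

lemma Invariant.mem_ballB (hz : Invariant f W β Xinit z)
    (hpar : ParameterAssumption f W β η Xinit) (hd : d ≠ 0) (i : Fin d) :
    z.1 i ∈ ballB d n p :=
  mem_ballB_of_norm_sub_le hd hz.avg_mem ((norm_le_stackNorm (fun i => avg z.1 - z.1 i) i).trans
    (hz.consensus_fst_le hpar hd))

lemma Invariant.norm_avg_snd_le (hz : Invariant f W β Xinit z) (hf : SmoothAssumption f)
    (hpar : ParameterAssumption f W β η Xinit) (hd : d ≠ 0) :
    ‖avg z.2‖ ≤ Mg f + β * Mb d n p := by
  rw [hz.tracking]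
  exact norm_avg_le (add_nonneg (Mg_nonneg f) (mul_nonneg hpar.beta_pos.le (Mb_nonneg d n p))) _
    fun i => norm_dirH_le hf hpar.beta_pos.le (hz.mem_ballB hpar hd i) i

lemma Invariant.sqrt_mul_norm_tracking_error_le (hz : Invariant f W β Xinit z)
    (hf : SmoothAssumption f) (hpar : ParameterAssumption f W β η Xinit) (hd : d ≠ 0) :
    Real.sqrt d * ‖avg z.2 - dirH (objective f) β (avg z.1)‖
      ≤ Ltot f β * consensusError z.1 := by
  rw [hz.tracking, dirH_objective hf hd, ← avg_sub]
  refine (sqrt_mul_norm_avg_le hd _).trans ?_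
  refine stackNorm_le_mul (Ltot_nonneg f hpar.beta_pos.le) fun i => ?_
  rw [norm_sub_rev (avg z.1)]
  exact norm_dirH_sub_le hf hpar.beta_pos.le (hz.mem_ballB hpar hd i)
    (regionR_subset_ballB hd hz.avg_mem) i

lemma Invariant.norm_tracking_error_le_one (hz : Invariant f W β Xinit z)
    (hf : SmoothAssumption f) (hpar : ParameterAssumption f W β η Xinit) (hd : d ≠ 0) :
    ‖avg z.2 - dirH (objective f) β (avg z.1)‖ ≤ 1 := by
  have hd' : 0 < Real.sqrt d := Real.sqrt_pos.2 (Nat.cast_pos.2 (Nat.pos_of_ne_zero hd))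
  have h := (hz.sqrt_mul_norm_tracking_error_le hf hpar hd).trans hz.consensus_fst
  exact le_of_mul_le_mul_left (by linarith) hd'

lemma avg_sub_smul (η : ℝ) (X D : Fin d → Mat n p) :
    (avg fun i => X i - η • D i) = avg X - η • avg D := by
  rw [avg_sub]
  simp only [avg, ← Finset.smul_sum]
  rw [smul_comm]

lemma consensusError_step_le (hd : d ≠ 0) (hW : MixingAssumption 𝒢 W) (hη : 0 ≤ η)
    (X D : Fin d → Mat n p) :
    consensusError (mix W fun i => X i - η • D i)
      ≤ mixingRate W * (consensusError X + η * consensusError D) := by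
  refine (consensusError_mix_le hd hW _).trans ?_
  refine mul_le_mul_of_nonneg_left ?_ (mixingRate_nonneg W)
  have e : (fun i => (avg fun i => X i - η • D i) - (X i - η • D i))
      = fun i => (avg X - X i) - η • (avg D - D i) := by
    funext i
    rw [avg_sub_smul, smul_sub]
    abel
  rw [consensusError, e]
  refine (stackNorm_sub_le _ _).trans ?_
  rw [stackNorm_smul hη]
  rfl

lemma stackNorm_step_sub_le (hd : d ≠ 0) (hW : MixingAssumption 𝒢 W) (hη : 0 ≤ η)
    (hrate : mixingRate W ≤ 1) (X D : Fin d → Mat n p) :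
    stackNorm (fun i => mix W (fun i => X i - η • D i) i - X i)
      ≤ 2 * consensusError X + η * (mixingRate W * consensusError D)
        + η * (Real.sqrt d * ‖avg D‖) := by
  set X' := mix W fun i => X i - η • D i with hX'
  have havg : avg X' = avg X - η • avg D := by
    rw [hX', avg_mix hW, avg_sub_smul]
  have e : (fun i => X' i - X i)
      = fun i => ((X' i - avg X') + (avg X - X i)) - η • avg D := by
    funext i
    rw [havg]
    abel
  rw [e]
  refine (stackNorm_sub_le _ _).trans ?_
  have h1 := stackNorm_add_le (fun i => X' i - avg X') (fun i => avg X - X i)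
  rw [stackNorm_sub_avg] at h1
  have h2 := consensusError_step_le hd hW hη X D
  rw [← hX'] at h2
  have h3 : stackNorm (fun _ : Fin d => η • avg D) = η * (Real.sqrt d * ‖avg D‖) := by
    rw [stackNorm_smul hη fun _ : Fin d => avg D, stackNorm_const]
  have h4 := mul_le_mul_of_nonneg_right hrate (consensusError_nonneg X)
  have h5 : stackNorm (fun i => avg X - X i) = consensusError X := rfl
  rw [h3]
  linarith

end Step

section Iteration

variable {𝒢 : SimpleGraph (Fin d)} {k : ℕ}

lemma avg_iter_succ_fst (hW : MixingAssumption 𝒢 W) :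
    avg (iter f W β η Xinit (k + 1)).1
      = avg (iter f W β η Xinit k).1 - η • avg (iter f W β η Xinit k).2 := by
  rw [iter_succ_fst, avg_mix hW, avg_sub_smul]

lemma avg_iter_snd (hW : MixingAssumption 𝒢 W) (k : ℕ) :
    avg (iter f W β η Xinit k).2
      = avg fun i => dirH (f i) β ((iter f W β η Xinit k).1 i) := by
  induction k with
  | zero => rfl
  | succ k ih =>
    rw [iter_succ_snd]
    have e (A B : Fin d → Mat n p) : (avg fun i => A i + B i) = avg A + avg B := by
      simp [avg, Finset.sum_add_distrib, smul_add]
    rw [e, avg_mix hW, avg_sub, ih]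
    abel

/-- The consensus error of the directions after one step. -/
lemma consensusError_iter_succ_snd_le (hf : SmoothAssumption f) (hd : d ≠ 0)
    (hW : MixingAssumption 𝒢 W) (hpar : ParameterAssumption f W β η Xinit)
    (hk : ∀ i, (iter f W β η Xinit k).1 i ∈ ballB d n p)
    (hk' : ∀ i, (iter f W β η Xinit (k + 1)).1 i ∈ ballB d n p) :
    consensusError (iter f W β η Xinit (k + 1)).2
      ≤ mixingRate W * consensusError (iter f W β η Xinit k).2
        + Ltot f β * (2 * consensusError (iter f W β η Xinit k).1
          + η * (mixingRate W * consensusError (iter f W β η Xinit k).2)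
          + η * (Real.sqrt d * ‖avg (iter f W β η Xinit k).2‖)) := by
  rw [iter_succ_snd]
  refine (consensusError_add_le _ _).trans
    (add_le_add (consensusError_mix_le hd hW _) ?_)
  refine (consensusError_le_stackNorm hd _).trans ?_
  have h1 := stackNorm_le_mul (Ltot_nonneg f hpar.beta_pos.le)
    (fun i => norm_dirH_sub_le hf hpar.beta_pos.le (hk' i) (hk i) i)
  refine h1.trans (mul_le_mul_of_nonneg_left ?_ (Ltot_nonneg f hpar.beta_pos.le))
  exact stackNorm_step_sub_le hd hW hpar.eta_pos.le hpar.rate_lt_one.le _ _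

lemma invariant_zero (hd : d ≠ 0) (hX : Xinit ∈ regionR n p)
    (hpar : ParameterAssumption f W β η Xinit) :
    Invariant f W β Xinit (iter f W β η Xinit 0) where
  avg_mem := by
    change avg (fun _ : Fin d => Xinit) ∈ _
    rwa [avg_const hd]
  consensus_fst := by
    change Ltot f β * consensusError (fun _ : Fin d => Xinit) ≤ _
    rw [consensusError_const hd, mul_zero]
    exact Real.sqrt_nonneg _
  consensus_snd := by
    have h1 : 0 < 1 - mixingRate W := by linarith [hpar.rate_lt_one]
    have h2 : 0 ≤ 3 * Real.sqrt d / (1 - mixingRate W) := by positivity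
    change consensusError (fun i => dirH (f i) β Xinit) ≤ _
    linarith
  tracking := rfl

lemma invariant_succ (hf : SmoothAssumption f) (hd : d ≠ 0) (hW : MixingAssumption 𝒢 W)
    (hpar : ParameterAssumption f W β η Xinit)
    (hz : Invariant f W β Xinit (iter f W β η Xinit k)) :
    Invariant f W β Xinit (iter f W β η Xinit (k + 1)) := by
  have hη := hpar.eta_pos
  have hL := hpar.Ltot_pos
  have hr := hpar.rate_lt_one
  have hr0 := mixingRate_nonneg W
  set x := consensusError (iter f W β η Xinit k).1 with hx
  set y := consensusError (iter f W β η Xinit k).2 with hy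
  set w := ‖avg (iter f W β η Xinit k).2‖ with hw
  have hx0 : 0 ≤ x := consensusError_nonneg _
  have hy0 : 0 ≤ y := consensusError_nonneg _
  have hyw : y + Real.sqrt d * w ≤ CD f W β Xinit := by
    have h1 := hz.consensus_snd
    have h2 := mul_le_mul_of_nonneg_left (hz.norm_avg_snd_le hf hpar hd)
      (Real.sqrt_nonneg (d : ℝ))
    rw [CD]
    linarith
  have hsw : 0 ≤ Real.sqrt d * w := mul_nonneg (Real.sqrt_nonneg _) (norm_nonneg _)
  have hyC : y ≤ CD f W β Xinit := by linarith
  have hmem : avg (iter f W β η Xinit (k + 1)).1 ∈ regionR n p := by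
    rw [avg_iter_succ_fst hW]
    set A := avg (iter f W β η Xinit k).1 with hA
    set e := avg (iter f W β η Xinit k).2 - dirH (objective f) β A with he
    have hP : ‖dirG (objective f) A + e‖ ≤ 1 + Mg f := by
      refine (norm_add_le _ _).trans ?_
      have h1 := hz.norm_tracking_error_le_one hf hpar hd
      have h2 := norm_dirG_objective_le hf (regionR_subset_ballB hd hz.avg_mem)
      rw [← hA] at h1 h2
      linarith
    have hstep : avg (iter f W β η Xinit k).2
        = (dirG (objective f) A + e) + β • (A * gap A) := by
      rw [he, dirH_eq]
      abel
    rw [hstep]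
    exact sub_smul_mem_regionR hz.avg_mem _ hP (Mg_nonneg f) hpar.beta2 hη hpar.eta1 hpar.eta4
  have hxs : Ltot f β * consensusError (iter f W β η Xinit (k + 1)).1 ≤ Real.sqrt d := by
    have h1 := consensusError_step_le hd hW hη.le (iter f W β η Xinit k).1
      (iter f W β η Xinit k).2
    rw [← iter_succ_fst, ← hx, ← hy] at h1
    have h2 := mul_le_mul_of_nonneg_left h1 hL.le
    have h3 := mul_le_mul_of_nonneg_left hz.consensus_fst hr0
    have h4 := hpar.eta_mul_rate_mul_CD_le
    have h5 : Ltot f β * (mixingRate W * (η * y))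
        ≤ Ltot f β * (mixingRate W * (η * CD f W β Xinit)) := by gcongr
    linarith
  have hball (i : Fin d) : (iter f W β η Xinit (k + 1)).1 i ∈ ballB d n p := by
    refine mem_ballB_of_norm_sub_le hd hmem ?_
    refine (norm_le_stackNorm
      (fun i => avg (iter f W β η Xinit (k + 1)).1 - (iter f W β η Xinit (k + 1)).1 i) i).trans ?_
    change consensusError (iter f W β η Xinit (k + 1)).1 ≤ _
    nlinarith [hpar.one_lt_Ltot hd, consensusError_nonneg (iter f W β η Xinit (k + 1)).1]
  refine ⟨hmem, hxs, ?_, avg_iter_snd hW _⟩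
  refine (consensusError_iter_succ_snd_le hf hd hW hpar (hz.mem_ballB hpar hd) hball).trans ?_
  rw [← hx, ← hy, ← hw]
  have h1 : 0 < 1 - mixingRate W := by linarith
  have h2 : Ltot f β * (η * (mixingRate W * y) + η * (Real.sqrt d * w)) ≤ Real.sqrt d := by
    refine le_trans ?_ hpar.eta_mul_CD_le
    have h3 : mixingRate W * y ≤ y := by nlinarith
    have h4 : η * (mixingRate W * y) + η * (Real.sqrt d * w) ≤ η * CD f W β Xinit := by
      rw [← mul_add]
      gcongr
      linarith
    gcongr
  have h3 := mul_le_mul_of_nonneg_left hz.consensus_snd hr0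
  have h4 : mixingRate W * (3 * Real.sqrt d / (1 - mixingRate W)) + 3 * Real.sqrt d
      = 3 * Real.sqrt d / (1 - mixingRate W) := by
    field_simp
    ring
  have h5 : mixingRate W * consensusError (fun i => dirH (f i) β Xinit)
      ≤ consensusError (fun i => dirH (f i) β Xinit) := by
    nlinarith [consensusError_nonneg fun i => dirH (f i) β Xinit]
  have h6 := hz.consensus_fst
  rw [← hx] at h6
  rw [← hy] at h3
  linarith

lemma invariant_iter (hf : SmoothAssumption f) (hd : d ≠ 0) (hW : MixingAssumption 𝒢 W)
    (hpar : ParameterAssumption f W β η Xinit) (hX : Xinit ∈ regionR n p) (k : ℕ) :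
    Invariant f W β Xinit (iter f W β η Xinit k) := by
  induction k with
  | zero => exact invariant_zero hd hX hpar
  | succ k ih => exact invariant_succ hf hd hW hpar ih

end Iteration

end

end Destiny

namespace Destiny

variable {d n p : ℕ}

section

attribute [local instance] matTopology

variable {f : Fin d → Mat n p → ℝ} {W : Mat d d} {β η : ℝ} {Xinit : Mat n p}
  {𝒢 : SimpleGraph (Fin d)} {k : ℕ}

/-! ### Decrease of the merit function -/

/-- Weighted Young inequality for a contraction with factor `l < 1`. -/
lemma sq_add_le_of_rate {l x y : ℝ} (hl : 0 < 1 - l ^ 2) :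
    (l * x + y) ^ 2 ≤ (1 + l ^ 2) / 2 * x ^ 2 + (1 + l ^ 2) / (1 - l ^ 2) * y ^ 2 := by
  rw [div_mul_eq_mul_div (1 + l ^ 2) (1 - l ^ 2), ← sub_le_iff_le_add', le_div_iff₀ hl]
  nlinarith [sq_nonneg ((1 - l ^ 2) * x - 2 * l * y)]

/-- The penalty function along the averages of the iterates. -/
lemma penaltyH_avg_succ_le (hf : SmoothAssumption f) (hd : d ≠ 0) (hW : MixingAssumption 𝒢 W)
    (hpar : ParameterAssumption f W β η Xinit) (hX : Xinit ∈ regionR n p) (k : ℕ) :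
    penaltyH (objective f) β (avg (iter f W β η Xinit (k + 1)).1)
      ≤ penaltyH (objective f) β (avg (iter f W β η Xinit k).1)
        - η / 2 * ‖dirG (objective f) (avg (iter f W β η Xinit k).1)‖ ^ 2
        - η * β / 4 * ‖gap (avg (iter f W β η Xinit k).1)‖ ^ 2
        - η / 8 * ‖avg (iter f W β η Xinit k).2‖ ^ 2
        + (1 - mixingRate W ^ 2) / 24 * consensusError (iter f W β η Xinit k).1 ^ 2 := by
  have hz := invariant_iter hf hd hW hpar hX k
  have hz' := invariant_iter hf hd hW hpar hX (k + 1)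
  have hη := hpar.eta_pos
  have hβ := hpar.beta_large
  have hd' : (0 : ℝ) < d := Nat.cast_pos.2 (Nat.pos_of_ne_zero hd)
  set A := avg (iter f W β η Xinit k).1 with hA
  set D := avg (iter f W β η Xinit k).2 with hD
  set H := dirH (objective f) β A with hH
  have hstep : avg (iter f W β η Xinit (k + 1)).1 = A + -(η • D) := by
    rw [avg_iter_succ_fst hW, ← sub_eq_add_neg]
  have hAR : A ∈ regionR n p := hz.avg_mem
  have hAB : A ∈ ballB d n p := regionR_subset_ballB hd hAR
  have hAB' : A + -(η • D) ∈ ballB d n p := by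
    rw [← hstep]
    exact regionR_subset_ballB hd hz'.avg_mem
  have key := penaltyH_le hf hd (by linarith) hAB hAB'
  rw [norm_neg, norm_smul, Real.norm_of_nonneg hη.le, inner_neg_right, real_inner_smul_right,
    ← hH] at key
  have hLf := Lf_nonneg f
  have hLb := Lb_nonneg d n p
  have hLg := Lg_nonneg f
  have hin : 2 * inner ℝ H D = ‖H‖ ^ 2 + ‖D‖ ^ 2 - ‖D - H‖ ^ 2 := by
    rw [norm_sub_sq_real, real_inner_comm]
    ring
  have hHge : ‖dirG (objective f) A‖ ^ 2 + β * ‖gap A‖ ^ 2 ≤ ‖H‖ ^ 2 :=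
    norm_sq_add_smul_ge hAR _ (norm_matGrad_le_C0 hf hAR) hpar.beta1
  have herr : ‖D - H‖ ^ 2 ≤ Ltot f β ^ 2 / d * consensusError (iter f W β η Xinit k).1 ^ 2 := by
    have h1 := pow_le_pow_left₀ (by positivity)
      (hz.sqrt_mul_norm_tracking_error_le hf hpar hd) 2
    rw [mul_pow, Real.sq_sqrt hd'.le, mul_pow] at h1
    rw [div_mul_eq_mul_div, le_div_iff₀ hd']
    linarith
  have herr' : η * ‖D - H‖ ^ 2
      ≤ (1 - mixingRate W ^ 2) / 12 * consensusError (iter f W β η Xinit k).1 ^ 2 := by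
    have h1 := mul_le_mul_of_nonneg_right (hpar.eta_mul_Ltot_sq_le hd)
      (sq_nonneg (consensusError (iter f W β η Xinit k).1))
    have h2 := mul_le_mul_of_nonneg_left herr hη.le
    linarith
  have hcross : 3 / 2 * Lf f * ‖A * gap A‖ * (η * ‖D‖)
      ≤ η * (‖D‖ ^ 2 / 4 + β / 4 * ‖gap A‖ ^ 2) := by
    have h1 : (Lf f * ‖A * gap A‖) ^ 2 ≤ β / 22 * (7 / 6 * ‖gap A‖ ^ 2) := by
      rw [mul_pow]
      have := hpar.beta4
      exact mul_le_mul (by linarith) (norm_sq_mul_le_of_mem hAR _) (sq_nonneg _) (by linarith)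
    have h2 : 3 / 2 * (Lf f * ‖A * gap A‖) * ‖D‖ ≤ ‖D‖ ^ 2 / 4 + β / 4 * ‖gap A‖ ^ 2 := by
      have h3 : 0 ≤ β * ‖gap A‖ ^ 2 := mul_nonneg (by linarith) (sq_nonneg _)
      nlinarith [sq_nonneg (‖D‖ / 2 - 3 / 2 * (Lf f * ‖A * gap A‖))]
    calc _ = η * (3 / 2 * (Lf f * ‖A * gap A‖) * ‖D‖) := by ring
      _ ≤ _ := by gcongr
  have hquad : (Ltot f β + 3 / 2 * Lf f * Lb d n p) / 2 * (η * ‖D‖) ^ 2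
      ≤ η / 8 * ‖D‖ ^ 2 := by
    have h1 : 3 / 2 * Lf f * Lb d n p ≤ Ltot f β := by
      have h2 : Lf f * Lb d n p ≤ β / 30 * Lb d n p := by
        gcongr
        exact hpar.Lf_le
      have h3 : 0 ≤ β * Lb d n p := mul_nonneg (by linarith) hLb
      rw [Ltot]
      linarith
    calc _ ≤ (Ltot f β + Ltot f β) / 2 * (η * ‖D‖) ^ 2 := by gcongr
      _ = (η * Ltot f β) * (η * ‖D‖ ^ 2) := by ring
      _ ≤ 1 / 8 * (η * ‖D‖ ^ 2) := by
        gcongr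
        exact hpar.eta_mul_Ltot_le
      _ = _ := by ring
  have hHge' := mul_le_mul_of_nonneg_left hHge hη.le
  rw [hstep]
  linear_combination key + hcross + hquad + herr' / 2 + hHge' / 2 - η / 2 * hin

/-- The squared consensus error of the local variables after one step. -/
lemma ParameterAssumption.sq_fst_le (hpar : ParameterAssumption f W β η Xinit) {x y x' : ℝ}
    (hx0' : 0 ≤ x') (hx' : x' ≤ mixingRate W * (x + η * y)) :
    x' ^ 2 ≤ (1 + mixingRate W ^ 2) / 2 * x ^ 2
      + 3 / 16 * rho f W β * (1 - mixingRate W ^ 2) * y ^ 2 := by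
  have hs := hpar.one_sub_sq_pos
  have h1 := mul_le_mul_of_nonneg_right hpar.eta_sq_mul_C1_le (sq_nonneg y)
  have h2 := sq_add_le_of_rate (x := x) (y := mixingRate W * (η * y)) hs
  have h3 : (1 + mixingRate W ^ 2) / (1 - mixingRate W ^ 2) * (mixingRate W * (η * y)) ^ 2
      = η ^ 2 * C1 W * y ^ 2 := by
    rw [C1]
    ring
  have h4 := pow_le_pow_left₀ hx0' hx' 2
  rw [mul_add] at h4
  linarith

/-- The squared consensus error of the directions after one step. -/
lemma ParameterAssumption.sq_snd_le (hpar : ParameterAssumption f W β η Xinit) {x y w y' : ℝ}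
    (hy0' : 0 ≤ y') (hy' : y' ≤ mixingRate W * y + Ltot f β * (2 * x
      + η * (mixingRate W * y) + η * (Real.sqrt d * w))) :
    y' ^ 2 ≤ (1 + mixingRate W ^ 2) / 2 * y ^ 2
      + C2 f W β * (x ^ 2 + η ^ 2 * mixingRate W ^ 2 * y ^ 2 / 4 + η ^ 2 * d * w ^ 2 / 4) := by
  have hs := hpar.one_sub_sq_pos
  set l := mixingRate W with hl
  set a := 2 * x + η * (l * y) + η * (Real.sqrt d * w) with ha
  have h1 := sq_add_le_of_rate (x := y) (y := Ltot f β * a) hs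
  have h2 := pow_le_pow_left₀ hy0' hy' 2
  have h3 : a ^ 2 ≤ 12 * (x ^ 2 + η ^ 2 * l ^ 2 * y ^ 2 / 4 + η ^ 2 * d * w ^ 2 / 4) := by
    have e : (Real.sqrt d) ^ 2 = (d : ℝ) := Real.sq_sqrt (Nat.cast_nonneg d)
    rw [← e, ha]
    nlinarith [sq_nonneg (2 * x - η * (l * y)), sq_nonneg (2 * x - η * (Real.sqrt d * w)),
      sq_nonneg (η * (l * y) - η * (Real.sqrt d * w))]
  have h5 : 0 ≤ (1 + l ^ 2) / (1 - l ^ 2) * Ltot f β ^ 2 := by positivity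
  have h6 := mul_le_mul_of_nonneg_left h3 h5
  have e : C2 f W β = (1 + l ^ 2) / (1 - l ^ 2) * Ltot f β ^ 2 * 12 := by
    rw [C2, ← hl]
    ring
  rw [e]
  linarith

lemma ParameterAssumption.rho_mul_sq_snd_le (hpar : ParameterAssumption f W β η Xinit)
    (hd : d ≠ 0) {x y w y' : ℝ} (hy0' : 0 ≤ y')
    (hy' : y' ≤ mixingRate W * y + Ltot f β * (2 * x
      + η * (mixingRate W * y) + η * (Real.sqrt d * w))) :
    rho f W β * y' ^ 2 ≤ rho f W β * ((1 + mixingRate W ^ 2) / 2) * y ^ 2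
      + 3 / 16 * (1 - mixingRate W ^ 2) * x ^ 2
      + 9 / 1024 * rho f W β * (1 - mixingRate W ^ 2) * y ^ 2 + η / 16 * w ^ 2 := by
  have hη := hpar.eta_pos
  have hs := hpar.one_sub_sq_pos
  have h1 := mul_le_mul_of_nonneg_left (hpar.sq_snd_le hy0' hy') hpar.rho_pos.le
  have h2 := hpar.rho_mul_C2
  have h4 := mul_le_mul_of_nonneg_right hpar.eta_sq_mul_rate_sq_le
    (mul_nonneg hs.le (sq_nonneg y))
  have h6 := mul_le_mul_of_nonneg_right (hpar.eta_mul_rho_le hd)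
    (mul_nonneg hη.le (sq_nonneg w))
  set r := rho f W β
  set l := mixingRate W
  have h7 : r * (C2 f W β * (x ^ 2 + η ^ 2 * l ^ 2 * y ^ 2 / 4 + η ^ 2 * d * w ^ 2 / 4))
      = 3 / 16 * (1 - l ^ 2) * (x ^ 2 + η ^ 2 * l ^ 2 * y ^ 2 / 4)
        + r * C2 f W β * (η ^ 2 * d * w ^ 2 / 4) := by
    rw [← h2]
    ring
  linarith

/-- One iteration decreases the merit function by multiples of the squared consensus error, of
the squared direction and of the squared infeasibility at the average. -/
lemma merit_succ_le (hf : SmoothAssumption f) (hd : d ≠ 0) (hW : MixingAssumption 𝒢 W)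
    (hpar : ParameterAssumption f W β η Xinit) (hX : Xinit ∈ regionR n p) (k : ℕ) :
    merit f W β (iter f W β η Xinit (k + 1))
        + 3 * (1 - mixingRate W ^ 2) / 16 * consensusError (iter f W β η Xinit k).1 ^ 2
        + η / 2 * ‖dirG (objective f) (avg (iter f W β η Xinit k).1)‖ ^ 2
        + η * β / 4 * ‖gap (avg (iter f W β η Xinit k).1)‖ ^ 2
      ≤ merit f W β (iter f W β η Xinit k) := by
  have hz := invariant_iter hf hd hW hpar hX k
  have hz' := invariant_iter hf hd hW hpar hX (k + 1)
  have hh := penaltyH_avg_succ_le hf hd hW hpar hX k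
  have hη := hpar.eta_pos
  have hx' := consensusError_step_le hd hW hη.le (iter f W β η Xinit k).1
    (iter f W β η Xinit k).2
  rw [← iter_succ_fst] at hx'
  have hy' := consensusError_iter_succ_snd_le hf hd hW hpar (hz.mem_ballB hpar hd)
    (hz'.mem_ballB hpar hd)
  have hxx := hpar.sq_fst_le (consensusError_nonneg _) hx'
  have hyy := hpar.rho_mul_sq_snd_le hd (consensusError_nonneg _) hy'
  have hw0 := mul_nonneg hη.le (sq_nonneg ‖avg (iter f W β η Xinit k).2‖)
  have hx0 := mul_nonneg hpar.one_sub_sq_pos.le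
    (sq_nonneg (consensusError (iter f W β η Xinit k).1))
  have hy0 := mul_nonneg (mul_nonneg hpar.rho_pos.le hpar.one_sub_sq_pos.le)
    (sq_nonneg (consensusError (iter f W β η Xinit k).2))
  rw [merit, merit]
  linarith

/-- The decrease of the merit function in terms of each of the three quantities. -/
lemma merit_succ_add_le (hf : SmoothAssumption f) (hd : d ≠ 0) (hW : MixingAssumption 𝒢 W)
    (hpar : ParameterAssumption f W β η Xinit) (hX : Xinit ∈ regionR n p) (k : ℕ) :
    merit f W β (iter f W β η Xinit (k + 1))
        + 3 * (1 - mixingRate W ^ 2) / 16 * consensusError (iter f W β η Xinit k).1 ^ 2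
      ≤ merit f W β (iter f W β η Xinit k) ∧
    merit f W β (iter f W β η Xinit (k + 1))
        + η / 2 * ‖dirG (objective f) (avg (iter f W β η Xinit k).1)‖ ^ 2
      ≤ merit f W β (iter f W β η Xinit k) ∧
    merit f W β (iter f W β η Xinit (k + 1))
        + η * β / 4 * ‖gap (avg (iter f W β η Xinit k).1)‖ ^ 2
      ≤ merit f W β (iter f W β η Xinit k) := by
  have hη := hpar.eta_pos
  have hβ := hpar.beta_pos
  have hs := hpar.one_sub_sq_pos
  have hm := merit_succ_le hf hd hW hpar hX k
  have h1 : 0 ≤ 3 * (1 - mixingRate W ^ 2) / 16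
      * consensusError (iter f W β η Xinit k).1 ^ 2 := by positivity
  have h2 : 0 ≤ η / 2 * ‖dirG (objective f) (avg (iter f W β η Xinit k).1)‖ ^ 2 := by
    positivity
  have h3 : 0 ≤ η * β / 4 * ‖gap (avg (iter f W β η Xinit k).1)‖ ^ 2 := by positivity
  exact ⟨by linarith, by linarith, by linarith⟩

/-! ### Consequences of the decrease -/

lemma sum_le_of_add_le {m u : ℕ → ℝ} {c hlow : ℝ} (h : ∀ k, m (k + 1) + c * u k ≤ m k)
    (hlow_le : ∀ k, hlow ≤ m k) (K : ℕ) :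
    c * ∑ k ∈ Finset.range K, u k ≤ m 0 - hlow := by
  have h1 : c * ∑ k ∈ Finset.range K, u k ≤ m 0 - m K := by
    induction K with
    | zero => simp
    | succ K ih =>
      rw [Finset.sum_range_succ, mul_add]
      linarith [h K]
  linarith [hlow_le K]

lemma minUpTo_le_of_add_le {m u : ℕ → ℝ} {c hlow : ℝ} (hc : 0 < c)
    (h : ∀ k, m (k + 1) + c * u k ≤ m k) (hlow_le : ∀ k, hlow ≤ m k) (K : ℕ) (hK : K ≠ 0) :
    minUpTo u K hK ≤ (m 0 - hlow) / (c * K) := by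
  have hK' : (0 : ℝ) < K := Nat.cast_pos.2 (Nat.pos_of_ne_zero hK)
  have h1 : (K : ℝ) * minUpTo u K hK ≤ ∑ k ∈ Finset.range K, u k := by
    have := Finset.card_nsmul_le_sum (Finset.range K) u (minUpTo u K hK)
      fun k hk => Finset.inf'_le u hk
    simpa using this
  have h2 := sum_le_of_add_le h hlow_le K
  rw [le_div_iff₀ (by positivity)]
  nlinarith

lemma tendsto_zero_of_add_le {m u : ℕ → ℝ} {c hlow : ℝ} (hc : 0 < c) (hu : ∀ k, 0 ≤ u k)
    (h : ∀ k, m (k + 1) + c * u k ≤ m k) (hlow_le : ∀ k, hlow ≤ m k) :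
    Tendsto u atTop (𝓝 0) := by
  refine (summable_of_sum_range_le (c := (m 0 - hlow) / c) hu fun K => ?_).tendsto_atTop_zero
  rw [le_div_iff₀ hc, mul_comm]
  exact sum_le_of_add_le h hlow_le K

lemma continuous_penaltyH (hf : SmoothAssumption f) (β : ℝ) :
    Continuous (penaltyH (objective f) β) := by
  have h := (differentiable_objective hf).continuous
  exact ((continuous_const.mul h).sub
    (continuous_const.mul (h.comp contDiff_cubic.continuous))).add
    (continuous_const.mul contDiff_penaltyB.continuous)

lemma bddBelow_merit (hf : SmoothAssumption f) (hd : d ≠ 0) (hW : MixingAssumption 𝒢 W)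
    (hpar : ParameterAssumption f W β η Xinit) (hX : Xinit ∈ regionR n p) :
    ∃ hlow : ℝ, ∀ k, hlow ≤ merit f W β (iter f W β η Xinit k) := by
  obtain ⟨K, hK⟩ := (isCompact_regionR n p).bddBelow_image
    (continuous_penaltyH hf β).continuousOn
  refine ⟨K, fun k => ?_⟩
  have h1 := hK ⟨_, (invariant_iter hf hd hW hpar hX k).avg_mem, rfl⟩
  have h2 := mul_nonneg hpar.rho_pos.le (sq_nonneg (consensusError (iter f W β η Xinit k).2))
  rw [merit]
  linarith [sq_nonneg (consensusError (iter f W β η Xinit k).1)]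

/-- The iterates have an accumulation point. -/
lemma exists_mapClusterPt_iter (hf : SmoothAssumption f) (hd : d ≠ 0)
    (hW : MixingAssumption 𝒢 W) (hpar : ParameterAssumption f W β η Xinit)
    (hX : Xinit ∈ regionR n p) : ∃ zs, MapClusterPt zs atTop (iter f W β η Xinit) := by
  set c := consensusError (fun i => dirH (f i) β Xinit) + 3 * Real.sqrt d / (1 - mixingRate W)
    + (Mg f + β * Mb d n p)
  have hmem (k : ℕ) : iter f W β η Xinit k
      ∈ (Set.univ.pi fun _ : Fin d => ballB d n p)
        ×ˢ (Set.univ.pi fun _ : Fin d => Metric.closedBall (0 : Mat n p) c) := by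
    have hz := invariant_iter hf hd hW hpar hX k
    refine ⟨fun i _ => hz.mem_ballB hpar hd i, fun i _ => ?_⟩
    rw [mem_closedBall_zero_iff]
    have h1 := norm_le_norm_add_norm_sub (avg (iter f W β η Xinit k).2)
      ((iter f W β η Xinit k).2 i)
    have h2 := norm_le_stackNorm
      (fun i => avg (iter f W β η Xinit k).2 - (iter f W β η Xinit k).2 i) i
    have h3 := hz.consensus_snd
    have h4 := hz.norm_avg_snd_le hf hpar hd
    rw [consensusError] at h3
    linarith
  have hcomp : IsCompact ((Set.univ.pi fun _ : Fin d => ballB d n p)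
        ×ˢ (Set.univ.pi fun _ : Fin d => Metric.closedBall (0 : Mat n p) c)) :=
    (isCompact_univ_pi fun _ => isCompact_ballB d n p).prod
      (isCompact_univ_pi fun _ => isCompact_closedBall _ _)
  obtain ⟨zs, -, hzs⟩ := hcomp.exists_mapClusterPt (f := atTop) (u := iter f W β η Xinit)
    (Eventually.of_forall hmem |> tendsto_principal.2 : Tendsto _ _ _)
  exact ⟨zs, hzs⟩

lemma eq_zero_of_mapClusterPt {α : Type*} [TopologicalSpace α] {z : ℕ → α} {zs : α} {u : α → ℝ}
    (hu : Continuous u) (h : Tendsto (fun k => u (z k)) atTop (𝓝 0))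
    (hz : MapClusterPt zs atTop z) : u zs = 0 := by
  obtain ⟨ψ, hψ, hlim⟩ := (hz.continuousAt_comp hu.continuousAt).tendsto_subseq
  exact tendsto_nhds_unique hlim (h.comp hψ.tendsto_atTop)

lemma continuous_avg : Continuous (avg : (Fin d → Mat n p) → Mat n p) :=
  (continuous_finsetSum (f := fun i (Z : Fin d → Mat n p) => Z i) _
    fun i _ => continuous_apply i).const_smul (1 / (d : ℝ))

lemma continuous_consensusError :
    Continuous (consensusError : (Fin d → Mat n p) → ℝ) :=
  Real.continuous_sqrt.comp (continuous_finsetSum _ fun i _ =>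
    ((continuous_avg.sub (continuous_apply i)).norm.pow 2))

lemma continuous_dirG_objective (hf : SmoothAssumption f) : Continuous (dirG (objective f)) :=
  (locallyLipschitz_dirG (locallyLipschitz_matGrad_objective hf)).continuous

lemma isStationary_of_dirG_eq_zero {φ : Mat n p → ℝ} {X : Mat n p} (hX : gap X = 0)
    (hG : dirG φ X = 0) : IsStationary φ X := by
  have h1 : Xᵀ * X = 1 := sub_eq_zero.1 hX
  refine ⟨h1, ?_⟩
  have h2 : cubic X = X := by rw [cubic_eq, hX, Matrix.mul_zero, add_zero]
  rw [dirG, h2, h1, Matrix.mul_one] at hG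
  rw [← hG]
  congr 1
  module

/-- Accumulation points of the iterates are consensual and stationary. -/
lemma isStationary_of_mapClusterPt (hf : SmoothAssumption f) (hd : d ≠ 0)
    (hW : MixingAssumption 𝒢 W) (hpar : ParameterAssumption f W β η Xinit)
    (hX : Xinit ∈ regionR n p) {zs : (Fin d → Mat n p) × (Fin d → Mat n p)}
    (hzs : MapClusterPt zs atTop (iter f W β η Xinit)) :
    ∃ Xs : Mat n p, zs.1 = (fun _ => Xs) ∧ IsStationary (objective f) Xs := by
  obtain ⟨hlow, hlow_le⟩ := bddBelow_merit hf hd hW hpar hX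
  have hη := hpar.eta_pos
  have hβ := hpar.beta_pos
  have hs := hpar.one_sub_sq_pos
  have hm := merit_succ_add_le hf hd hW hpar hX
  have hx : Tendsto (fun k => consensusError (iter f W β η Xinit k).1 ^ 2) atTop (𝓝 0) :=
    tendsto_zero_of_add_le (c := 3 * (1 - mixingRate W ^ 2) / 16) (by positivity)
      (fun k => sq_nonneg _) (fun k => (hm k).1) hlow_le
  have hg : Tendsto (fun k => ‖dirG (objective f) (avg (iter f W β η Xinit k).1)‖ ^ 2)
      atTop (𝓝 0) :=
    tendsto_zero_of_add_le (c := η / 2) (by positivity)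
      (fun k => sq_nonneg _) (fun k => (hm k).2.1) hlow_le
  have hgap : Tendsto (fun k => ‖gap (avg (iter f W β η Xinit k).1)‖ ^ 2) atTop (𝓝 0) :=
    tendsto_zero_of_add_le (c := η * β / 4) (by positivity)
      (fun k => sq_nonneg _) (fun k => (hm k).2.2) hlow_le
  have hca : Continuous fun z : (Fin d → Mat n p) × (Fin d → Mat n p) => avg z.1 :=
    continuous_avg.comp continuous_fst
  have hx0 := eq_zero_of_mapClusterPt
    (u := fun z : (Fin d → Mat n p) × (Fin d → Mat n p) => consensusError z.1 ^ 2)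
    ((continuous_consensusError.comp continuous_fst).pow 2) hx hzs
  have hg0 := eq_zero_of_mapClusterPt
    (u := fun z : (Fin d → Mat n p) × (Fin d → Mat n p) => ‖dirG (objective f) (avg z.1)‖ ^ 2)
    (((continuous_dirG_objective hf).comp hca).norm.pow 2) hg hzs
  have hgap0 := eq_zero_of_mapClusterPt
    (u := fun z : (Fin d → Mat n p) × (Fin d → Mat n p) => ‖gap (avg z.1)‖ ^ 2)
    ((contDiff_gap.continuous.comp hca).norm.pow 2) hgap hzs
  refine ⟨avg zs.1, funext fun i => ?_, isStationary_of_dirG_eq_zero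
    (norm_eq_zero.1 (pow_eq_zero_iff two_ne_zero |>.1 hgap0))
    (norm_eq_zero.1 (pow_eq_zero_iff two_ne_zero |>.1 hg0))⟩
  have h1 := norm_le_stackNorm (fun i => avg zs.1 - zs.1 i) i
  have h2 : stackNorm (fun i => avg zs.1 - zs.1 i) = 0 := pow_eq_zero_iff two_ne_zero |>.1 hx0
  rw [h2] at h1
  exact (sub_eq_zero.1 (norm_le_zero_iff.1 h1)).symm

/-- The rates of convergence. -/
lemma minUpTo_le (hf : SmoothAssumption f) (hd : d ≠ 0) (hW : MixingAssumption 𝒢 W)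
    (hpar : ParameterAssumption f W β η Xinit) (hX : Xinit ∈ regionR n p) {hlow : ℝ}
    (hlow_le : ∀ k, hlow ≤ merit f W β (iter f W β η Xinit k)) (K : ℕ) (hK : K ≠ 0) :
    minUpTo (fun k => consensusError (iter f W β η Xinit k).1 ^ 2) K hK
        ≤ (merit f W β (iter f W β η Xinit 0) - hlow)
          / (3 * (1 - mixingRate W ^ 2) / 16 * K) ∧
    minUpTo (fun k => ‖dirG (objective f) (avg (iter f W β η Xinit k).1)‖ ^ 2) K hK
        ≤ (merit f W β (iter f W β η Xinit 0) - hlow) / (η / 2 * K) ∧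
    minUpTo (fun k => ‖gap (avg (iter f W β η Xinit k).1)‖ ^ 2) K hK
        ≤ (merit f W β (iter f W β η Xinit 0) - hlow) / (η * β / 4 * K) := by
  have hη := hpar.eta_pos
  have hβ := hpar.beta_pos
  have hs := hpar.one_sub_sq_pos
  have hm := merit_succ_add_le hf hd hW hpar hX
  exact ⟨minUpTo_le_of_add_le (m := fun k => merit f W β (iter f W β η Xinit k))
      (by positivity) (fun k => (hm k).1) hlow_le K hK,
    minUpTo_le_of_add_le (m := fun k => merit f W β (iter f W β η Xinit k))
      (by positivity) (fun k => (hm k).2.1) hlow_le K hK,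
    minUpTo_le_of_add_le (m := fun k => merit f W β (iter f W β η Xinit k))
      (by positivity) (fun k => (hm k).2.2) hlow_le K hK⟩

end

end Destiny

theorem mainTheorem1 {d n p : ℕ} (𝒢 : SimpleGraph (Fin d)) (h𝒢 : 𝒢.Connected)
    (f : Fin d → Destiny.Mat n p → ℝ) (hf : Destiny.SmoothAssumption f)
    (W : Destiny.Mat d d) (hW : Destiny.MixingAssumption 𝒢 W)
    (β η : ℝ) (Xinit : Destiny.Mat n p) (hX : Xinit ∈ Destiny.regionR n p)
    (hpar : Destiny.ParameterAssumption f W β η Xinit) :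
    let z := Destiny.iter f W β η Xinit
    let lam := Destiny.mixingRate W
    let m := fun k => Destiny.merit f W β (z k)
    -- existence of an accumulation point
    (∃ zs : (Fin d → Destiny.Mat n p) × (Fin d → Destiny.Mat n p), MapClusterPt zs atTop z) ∧
    -- every accumulation point is a consensus at a first-order stationary point
    (∀ zs : (Fin d → Destiny.Mat n p) × (Fin d → Destiny.Mat n p), MapClusterPt zs atTop z →
      ∃ Xs : Destiny.Mat n p,
        zs.1 = (fun _ => Xs) ∧ Destiny.IsStationary (Destiny.objective f) Xs) ∧
    -- the merit function is bounded below along the iterates, and the rates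
    BddBelow (Set.range m) ∧
    (∀ hlow : ℝ, (∀ k, hlow ≤ m k) → ∀ (K : ℕ) (hK : K ≠ 0),
      Destiny.minUpTo (fun k => Destiny.consensusError (z k).1 ^ 2) K hK
          ≤ 16 * (m 0 - hlow) / (3 * (1 - lam ^ 2) * K) ∧
      Destiny.minUpTo
          (fun k => ‖Destiny.dirG (Destiny.objective f) (Destiny.avg (z k).1)‖ ^ 2) K hK
          ≤ 2 * (m 0 - hlow) / (η * K) ∧
      (Destiny.Lf f ≠ 0 →
        Destiny.minUpTo
            (fun k => ‖(Destiny.avg (z k).1)ᵀ * Destiny.avg (z k).1 - 1‖ ^ 2) K hK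
          ≤ 2 * (m 0 - hlow) / (η * Destiny.Lf f ^ 2 * K))) ∧
    -- the last quantity is of order `1 / K` also when `Lf f = 0`
    (∃ C : ℝ, ∀ (K : ℕ) (hK : K ≠ 0),
      Destiny.minUpTo
          (fun k => ‖(Destiny.avg (z k).1)ᵀ * Destiny.avg (z k).1 - 1‖ ^ 2) K hK ≤ C / K) := by
  intro z lam m
  have hd : d ≠ 0 := by
    rintro rfl
    exact h𝒢.nonempty.elim fun i => i.elim0
  have hη := hpar.eta_pos
  have hβ := hpar.beta_pos
  have hs := hpar.one_sub_sq_pos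
  obtain ⟨low, hlow⟩ := Destiny.bddBelow_merit hf hd hW hpar hX
  refine ⟨Destiny.exists_mapClusterPt_iter hf hd hW hpar hX,
    fun zs hzs => Destiny.isStationary_of_mapClusterPt hf hd hW hpar hX hzs,
    ⟨low, by rintro _ ⟨k, rfl⟩; exact hlow k⟩, fun hl hle K hK => ?_,
    (Destiny.merit f W β (Destiny.iter f W β η Xinit 0) - low) / (η * β / 4), fun K hK => ?_⟩
  · obtain ⟨h1, h2, h3⟩ := Destiny.minUpTo_le hf hd hW hpar hX hle K hK
    have hK' : (0 : ℝ) < K := Nat.cast_pos.2 (Nat.pos_of_ne_zero hK)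
    refine ⟨h1.trans_eq ?_, h2.trans_eq ?_, fun hLf => h3.trans ?_⟩
    · simp only [z, lam, m]
      field_simp
    · simp only [z, m]
      field_simp
    · have hLf' : 0 < Destiny.Lf f := (Destiny.Lf_nonneg f).lt_of_ne' hLf
      have hnum : 0 ≤ Destiny.merit f W β (Destiny.iter f W β η Xinit 0) - hl :=
        sub_nonneg.2 (hle 0)
      have h4 := hpar.beta4
      calc (Destiny.merit f W β (Destiny.iter f W β η Xinit 0) - hl) / (η * β / 4 * K)
          ≤ (Destiny.merit f W β (Destiny.iter f W β η Xinit 0) - hl)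
            / (η * Destiny.Lf f ^ 2 / 2 * K) := by
            refine div_le_div_of_nonneg_left hnum (by positivity)
              (mul_le_mul_of_nonneg_right ?_ hK'.le)
            have h5 : Destiny.Lf f ^ 2 / 2 ≤ β / 4 := by linarith [sq_nonneg (Destiny.Lf f)]
            have h6 := mul_le_mul_of_nonneg_left h5 hη.le
            linarith
        _ = _ := by
            simp only [m, z]
            field_simp
  · refine (Destiny.minUpTo_le hf hd hW hpar hX hlow K hK).2.2.trans_eq ?_
    rw [div_div]
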